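/- **Model.** There are finitely many resources $i\in I$, with capacities $c_i\in\{1,2,\dots\}$ (numbers of identical units), rewards $r_i\ge 0$ and arbitrary known usage distributions $F_i$ on $[0,\infty]$. Vertices $t=1,\dots,T$ arrive in order at times $a(1)\le\dots\le a(T)$; when $t$ arrives, its edges $E_t\subseteq I$ are revealed, and $t$ is irrevocably matched to at most one resource $i\in E_t$ that has an available unit. A match of $t$ to $i$ earns $r_i$ and occupies one unit of $i$ during a random time $d_{it}\sim F_i$, independent of everything else; the unit is available again from time $a(t)+d_{it}$ on. Realized durations are observed only upon return. A (randomized) *online* algorithm knows $(c_i,r_i,F_i)_{i\in I}$ in advance and decides at $t$ from the arrivals up to $t$ and from what it has observed. The *clairvoyant* knows the whole arrival sequence in advance, but matches in order and observes durations only upon return; $\mathrm{OPT}$ is its optimal expected total reward. Put $c_{\min}=\min_i c_i$. An online algorithm is *non-adaptive* if its random choices do not depend on realized usage durations (a chosen resource that is unavailable is not matched). **Fluid guide.** Let $y(k_i,t)$ be the fraction of the unit $k\in\{1,\dots,c_i\}$ of $i$ that the guide matches to $t$. When $t$ arrives, the fraction of unit $k_i$ that is available is $Y(k_i)=1-\sum_{\tau<t}\bigl(1-F_i(a(t)-a(\tau))\bigr)\,y(k_i,\tau)$.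 While less than one unit in total has been matched to $t$ and some $i\in E_t$ has a unit with $Y(k_i)>0$: let $z_i$ be the largest $k$ with $Y(k_i)>0$, take $i\in E_t$ that maximizes the reduced price $r_i\,(1-e^{-z_i/c_i})$ (ties broken by an arbitrary fixed rule), and match to $t$ as much of the remaining fraction of that unit $z_i$ as possible without exceeding one unit in total for $t$. Put $x_{it}=\sum_k y(k_i,t)$. **SAMPLE.** When $t$ arrives, independently choose at most one resource, $i$ with probability $x_{it}/(1+\delta_i)$ where $\delta_i=\sqrt{2\log c_i/c_i}$; match $t$ to $i$ if a unit of $i$ is available, and leave $t$ unmatched otherwise. **Theorem.** SAMPLE is non-adaptive, and there is a function $\delta:\mathbb N\to\mathbb R$ with $\delta(c)=O\bigl(\sqrt{\log c/c}\bigr)$ as $c\to\infty$ such that, for all resources with arbitrary usage distributions, all tie-breaking rules and all arrival sequences, the expected total reward of SAMPLE is at least $\bigl(1-1/e-\delta(c_{\min})\bigr)\,\mathrm{OPT}$. Thus the guarantee tends to $1-1/e$ as $c_{\min}\to\infty$. This is asymptotically best possible: for every $\varepsilon>0$, every $N$ and every (randomized, possibly adaptive) online algorithm, there is an instance with $c_{\min}\ge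 N$, in which moreover no resource is reusable (all usage durations are infinite), on which the expected total reward of the algorithm is less than $(1-1/e+\varepsilon)\,\mathrm{OPT}$. -/

import Mathlib

open MeasureTheory Filter Topology Asymptotics
open scoped ENNReal NNReal

noncomputable section

namespace ReusableMatching

/-- The data known in advance: finitely many resources, each with a positive integral capacity,
a nonnegative reward per match, and an arbitrary distribution of the usage duration on `[0, ∞]`
(the value `∞` means that the unit never returns). -/
structure Resources where
  n : ℕ
  cap : Fin n → ℕ
  cap_pos : ∀ i, 0 < cap i
  reward : Fin n → ℝ≥0
  usage : Fin n → ProbabilityMeasure ℝ≥0∞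

namespace Resources

variable (R : Resources)

/-- The minimal capacity. -/
def cmin : ℕ := ⨅ i, R.cap i

/-- Units `k_i` of the resources. The unit `⟨i, k⟩` has rank `k + 1` among the units of `i`. -/
abbrev Item : Type := (i : Fin R.n) × Fin (R.cap i)

/-- The cumulative distribution function of the usage duration of resource `i`. -/
def cdf (i : Fin R.n) (x : ℝ) : ℝ := (R.usage i (Set.Iic (ENNReal.ofReal x)) : ℝ)

/-- No unit ever returns. -/
def IsNonReusable : Prop := ∀ i, (R.usage i : Measure ℝ≥0∞) = Measure.dirac ⊤

/-- What is revealed when a vertex arrives: its arrival time, and its incident edges. -/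
structure Arrival where
  time : ℝ
  nbrs : Finset (Fin R.n)

/-- A finite sequence of arrivals, in the order of their arrival times. -/
structure ArrivalSeq where
  T : ℕ
  arr : Fin T → R.Arrival
  mono : Monotone fun t => (arr t).time

/-! ### Clairvoyant and online algorithms, and their expected rewards -/

/-- A randomized clairvoyant algorithm on a sequence of `T` arrivals. At arrival `t` it chooses
at most one resource, depending on the past matches, on the past usage durations as far as they
have been observed by then, and on random seeds. Since it may depend in any way on the arrival
sequence, it knows that sequence in advance. -/
structure Policy (T : ℕ) where
  choose : (t : Fin T) → (past : Fin t → Option (Fin R.n)) → (obs : Fin t → ℝ≥0∞) →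
    (seed : Fin ((t : ℕ) + 1) → unitInterval) → Option (Fin R.n)
  measurable_choose : ∀ (t : Fin T) past i, MeasurableSet
    {q : (Fin t → ℝ≥0∞) × (Fin ((t : ℕ) + 1) → unitInterval) | choose t past q.1 q.2 = some i}

/-- A randomized online algorithm: in addition to what a clairvoyant algorithm observes, the
choice at an arrival may depend on the arrivals up to then, but on no later arrival. -/
structure OnlineAlgorithm where
  choose : (t : ℕ) → (arr : Fin ((t : ℕ) + 1) → R.Arrival) → (past : Fin t → Option (Fin R.n)) →
    (obs : Fin t → ℝ≥0∞) → (seed : Fin ((t : ℕ) + 1) → unitInterval) → Option (Fin R.n)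
  measurable_choose : ∀ (t : ℕ) arr past i, MeasurableSet
    {q : (Fin t → ℝ≥0∞) × (Fin ((t : ℕ) + 1) → unitInterval) | choose t arr past q.1 q.2 = some i}

variable {R}

/-- An online algorithm is non-adaptive if its choices do not depend on the realized usage
durations (neither directly nor through the past matches). -/
def OnlineAlgorithm.IsNonAdaptive (A : R.OnlineAlgorithm) : Prop :=
  ∀ t arr past past' obs obs' seed, A.choose t arr past obs seed = A.choose t arr past' obs' seed

/-- The first `t + 1` arrivals. -/
def initialArrivals {T : ℕ} (arr : Fin T → R.Arrival) (t : Fin T) :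
    Fin ((t : ℕ) + 1) → R.Arrival :=
  fun s => arr (Fin.castLE t.isLt s)

/-- The actions of an online algorithm on a sequence of arrivals. -/
def OnlineAlgorithm.toPolicy (A : R.OnlineAlgorithm) (G : R.ArrivalSeq) : R.Policy G.T where
  choose t := A.choose t (initialArrivals G.arr t)
  measurable_choose t past i := A.measurable_choose t (initialArrivals G.arr t) past i

/-- The resource matched to arrival `t`, if any, when the algorithm `P` is run with the random
seeds `u`, and a match of `t` to `i` lasts for the duration `d t i`. The chosen resource is
matched if it has an edge to `t` and a unit of it is available: a unit matched to an earlier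
arrival `s` is back as soon as the time since that match is at least its usage duration. The
duration of the match made at `s` is observed upon return; before the return, and if no match was
made at `s`, the observed value is `⊤`. -/
def matched (G : R.ArrivalSeq) (P : R.Policy G.T) (u : Fin G.T → unitInterval)
    (d : Fin G.T → Fin R.n → ℝ≥0∞) (t : Fin G.T) : Option (Fin R.n) :=
  let past : Fin t → Option (Fin R.n) := fun s => matched G P u d (Fin.castLE t.isLt.le s)
  let elapsed : Fin t → ℝ≥0∞ := fun s =>
    ENNReal.ofReal ((G.arr t).time - (G.arr (Fin.castLE t.isLt.le s)).time)
  let dur : Fin t → ℝ≥0∞ := fun s =>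
    match past s with
    | some i => d (Fin.castLE t.isLt.le s) i
    | none => ⊤
  let obs : Fin t → ℝ≥0∞ := fun s => if dur s ≤ elapsed s then dur s else ⊤
  let inUse : Fin R.n → ℕ := fun i =>
    (Finset.univ.filter fun s : Fin t => past s = some i ∧ elapsed s < dur s).card
  match P.choose t past obs (fun s => u (Fin.castLE t.isLt s)) with
  | some i => if i ∈ (G.arr t).nbrs ∧ inUse i < R.cap i then some i else none
  | none => none
termination_by t.val
decreasing_by exact s.isLt

/-- The reward of a match. -/
def matchReward : Option (Fin R.n) → ℝ≥0∞
  | some i => R.reward i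
  | none => 0

/-- The joint law of the seeds (independent and uniform on `[0, 1]`) and of the usage durations
`d t i` (independent, with the usage distribution of resource `i`). -/
def law (R : Resources) (T : ℕ) :
    Measure ((Fin T → unitInterval) × (Fin T → Fin R.n → ℝ≥0∞)) :=
  (Measure.pi fun _ => volume).prod
    (Measure.pi fun _ => Measure.pi fun i => (R.usage i : Measure ℝ≥0∞))

/-- The expected total reward of an algorithm. -/
def Policy.value (G : R.ArrivalSeq) (P : R.Policy G.T) : ℝ≥0∞ :=
  ∫⁻ ω, ∑ t, matchReward (matched G P ω.1 ω.2 t) ∂(law R G.T)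

/-- The expected total reward of the optimal clairvoyant algorithm. -/
def opt (G : R.ArrivalSeq) : ℝ≥0∞ := ⨆ P : R.Policy G.T, P.value G

/-- The expected total reward of an online algorithm. -/
def OnlineAlgorithm.value (A : R.OnlineAlgorithm) (G : R.ArrivalSeq) : ℝ≥0∞ :=
  (A.toPolicy G).value G

/-! ### The fluid guide -/

/-- A rule that breaks ties: it picks an element of every nonempty finite set. -/
structure TieBreak (α : Type) where
  pick : (S : Finset α) → S.Nonempty → α
  pick_mem : ∀ S h, pick S h ∈ S

/-- The reduced price `r_i (1 - g (k / c_i))` of the `k`-th unit of resource `i`, for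
`g x = exp (-x)`. -/
def price (p : R.Item) : ℝ :=
  R.reward p.1 * (1 - Real.exp (-(((p.2 : ℕ) + 1 : ℝ) / R.cap p.1)))

open Classical in
/-- Of each resource in `nbrs` with a unit of which a positive fraction remains, the highest such
unit. -/
def topItems (nbrs : Finset (Fin R.n)) (rem : R.Item → ℝ) : Finset R.Item :=
  Finset.univ.filter fun p => p.1 ∈ nbrs ∧ 0 < rem p ∧
    ∀ q : R.Item, q.1 = p.1 → 0 < rem q → (q.2 : ℕ) ≤ (p.2 : ℕ)

open Classical in
/-- Among the highest available units, those of maximal reduced price. -/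
def bestItems (nbrs : Finset (Fin R.n)) (rem : R.Item → ℝ) : Finset R.Item :=
  (topItems nbrs rem).filter fun p => ∀ q ∈ topItems nbrs rem, price q ≤ price p

open Classical in
/-- One pass of the inner loop of the guide at an arrival with edges to `nbrs`. Here `avail` are
the fractions of the units that are available upon arrival, and `y` are the fractions matched to
the arrival so far. Nothing changes if the arrival is completely matched, or if none of its
resources is available. -/
def guideStep (tb : TieBreak R.Item) (nbrs : Finset (Fin R.n)) (avail y : R.Item → ℝ) :
    R.Item → ℝ :=
  let rem : R.Item → ℝ := fun p => avail p - y p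
  let η : ℝ := ∑ p, y p
  if h : η < 1 ∧ (bestItems nbrs rem).Nonempty then
    let z := tb.pick (bestItems nbrs rem) h.2
    Function.update y z (y z + min (rem z) (1 - η))
  else y

/-- The fraction `y(k_i, t)` of each unit that the guide matches to arrival `t`. Reusability is
fluid: of a fraction that was matched at time `a(s)`, the part `F_i(a(t) - a(s))` is back at time
`a(t)`. Every pass of the inner loop, except for the last one that changes anything, uses up a
unit, so that `Fintype.card R.Item` passes complete the loop. -/
def guide (tb : TieBreak R.Item) {T : ℕ} (arr : Fin T → R.Arrival) (t : Fin T) : R.Item → ℝ :=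
  let avail : R.Item → ℝ := fun p => 1 - ∑ s : Fin t,
    (1 - R.cdf p.1 ((arr t).time - (arr (Fin.castLE t.isLt.le s)).time)) *
      guide tb arr (Fin.castLE t.isLt.le s) p
  (guideStep tb (arr t).nbrs avail)^[Fintype.card R.Item] 0
termination_by t.val
decreasing_by exact s.isLt

/-- The fraction `x_{it}` of arrival `t` that the guide matches to resource `i`. -/
def guideMatch (tb : TieBreak R.Item) {T : ℕ} (arr : Fin T → R.Arrival) (t : Fin T)
    (i : Fin R.n) : ℝ :=
  ∑ k : Fin (R.cap i), guide tb arr t ⟨i, k⟩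

/-! ### The algorithm SAMPLE -/

/-- `δ_i = √(2 log c_i / c_i)` -/
def slack (i : Fin R.n) : ℝ := √(2 * Real.log (R.cap i) / R.cap i)

/-- The first index `i` with `u < w 0 + ⋯ + w i`, if there is one. If `w` is nonnegative with sum
at most `1` and `u` is uniform on `[0, 1]`, then the index `i` is chosen with probability `w i`. -/
def sampleIndex {n : ℕ} (w : Fin n → ℝ) (u : ℝ) : Option (Fin n) := by
  classical
  exact (List.finRange n).find? fun i => decide (u < ∑ j ∈ Finset.Iic i, w j)

theorem measurableSet_sampleIndex {n : ℕ} (w : Fin n → ℝ) (i : Fin n) :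
    MeasurableSet {u : ℝ | sampleIndex w u = some i} := by
  classical
  have h : ∀ l : List (Fin n), MeasurableSet {u : ℝ |
      l.find? (fun i => decide (u < ∑ j ∈ Finset.Iic i, w j)) = some i} := by
    intro l
    induction l with
    | nil => simp
    | cons a l ih =>
      have : {u : ℝ | (a :: l).find? (fun i => decide (u < ∑ j ∈ Finset.Iic i, w j)) = some i} =
          ({u : ℝ | u < ∑ j ∈ Finset.Iic a, w j} ∩ {_u | a = i}) ∪
          ({u : ℝ | u < ∑ j ∈ Finset.Iic a, w j}ᶜ ∩ {u : ℝ |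
            l.find? (fun i => decide (u < ∑ j ∈ Finset.Iic i, w j)) = some i}) := by
        ext u
        by_cases hu : u < ∑ j ∈ Finset.Iic a, w j
        · simp [List.find?_cons, hu]
        · simp [List.find?_cons, hu]
      rw [this]
      have hm : MeasurableSet {u : ℝ | u < ∑ j ∈ Finset.Iic a, w j} := measurableSet_Iio
      exact (hm.inter (MeasurableSet.const _)).union (hm.compl.inter ih)
  exact h (List.finRange n)

/-- The algorithm SAMPLE: at arrival `t`, choose the resource `i` with probability
`x_{it} / (1 + δ_i)`, independently of everything before, where `x` is the fractional matching
that the guide computes from the arrivals so far; match `t` to the chosen resource if it is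
available. -/
def sample (R : Resources) (tb : TieBreak R.Item) : R.OnlineAlgorithm where
  choose t arr _ _ seed :=
    sampleIndex (fun i => guideMatch tb arr (Fin.last t) i / (1 + slack i)) (seed (Fin.last t))
  measurable_choose t arr _ i := by
    have hm : Measurable fun q : (Fin t → ℝ≥0∞) × (Fin ((t : ℕ) + 1) → unitInterval) =>
        ((q.2 (Fin.last t) : unitInterval) : ℝ) := by fun_prop
    exact hm (measurableSet_sampleIndex _ i)

end Resources

end ReusableMatching

end

open ReusableMatching Resources

/-! The guarantee goes through a fluid relaxation. For a clairvoyant policy let `o t i` be the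
probability that `t` is matched to `i`. The decision at `s` does not involve the duration drawn at
`s`, so the match is still running at `t` with probability `occupancy s t * o s i`; as no more than
`c_i` units are ever in use, `∑ s, occupancy s t * o s i ≤ c_i` (`sum_occupancy_mul_matchProb_le`).
It remains to show that the guide collects almost `1 - 1/e` of the reward of every such `o`, and
that SAMPLE loses little against the guide.

For the guide (`guide_competitive`) let `z` be the highest rank of `i` not exhausted after `t`, and
split `1 - 1/e = (1 - exp (-z/c)) + (exp (-z/c) - 1/e)`. The first part, times `r_i`, is at most the
total price collected at `t`, since the guide is greedy in prices. The second part is a sum over the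
exhausted units above `z`. It is paid for by the fluid matched to unit `k`, weighted by `r_i * exp
(-k/c)`, provided that the `o`-mass of the arrivals at which `k` is exhausted is at most `c_i` times
the fluid ever matched to `k`. With reusable units this is not evident; it is weak duality for the
triangular occupancy kernel (`sum_le_mul_sum`), and it uses nothing about `F_i` beyond monotonicity
and values in `[0, 1]`. Price and weight of a unit add up to its reward.

For SAMPLE, the choices at different arrivals and the durations are independent, and the expected
number of choices of `i` still running at `t` is at most `c_i / (1 + δ_i)`. A Chernoff bound makes
it improbable that all units are blocked (`le_matchProb_sample`).

For the upper bound, resources disappear from the neighbourhoods round by round in a uniformly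
random order. An online algorithm cannot distinguish the surviving resources, so on average it
spreads its matches evenly over them (`exists_perm_sum_le`), whereas the clairvoyant matches every
arrival. -/

noncomputable section

namespace ReusableMatching

namespace Resources

section

/-! ### A comparison lemma for lower triangular kernels -/

/-- A kernel `W s t`, vanishing for `t < s`, equal to `1` on the diagonal, nonnegative, and
monotone in `s` up to `t`. It models the probability that a unit occupied at `s` is still occupied
just after `t`, if it is not occupied again in between. -/
structure IsOccupancyKernel {ι : Type*} [LinearOrder ι] (W : ι → ι → ℝ) : Prop where
  nonneg : ∀ s t, 0 ≤ W s t
  diag : ∀ t, W t t = 1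
  eq_zero : ∀ s t, t < s → W s t = 0
  mono : ∀ s s' t, s ≤ s' → s' ≤ t → W s t ≤ W s' t

namespace IsOccupancyKernel

variable {ι : Type*} [LinearOrder ι] {W : ι → ι → ℝ}

/-- The row of `s` is dominated, on `S`, by the row of the first element of `S` from `s` on, where
the sum is exactly one. -/
theorem sum_le_one (hW : IsOccupancyKernel W) {S : Finset ι} {v : ι → ℝ}
    (hv : ∀ s ∈ S, ∑ t ∈ S, W s t * v t = 1) (hv0 : ∀ t, 0 ≤ v t) (s : ι) :
    ∑ t ∈ S, W s t * v t ≤ 1 := by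
  by_cases hS : (S.filter (s ≤ ·)).Nonempty
  · have hm := Finset.min'_mem _ hS
    rw [Finset.mem_filter] at hm
    rw [← hv _ hm.1]
    refine Finset.sum_le_sum fun t ht => mul_le_mul_of_nonneg_right ?_ (hv0 t)
    by_cases hst : s ≤ t
    · exact hW.mono _ _ _ hm.2 (Finset.min'_le _ _ (by simp [ht, hst]))
    · rw [hW.eq_zero _ _ (not_le.1 hst)]
      exact hW.nonneg _ _
  · rw [Finset.not_nonempty_iff_eq_empty] at hS
    rw [Finset.sum_eq_zero]
    · exact zero_le_one
    · intro t ht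
      have : ¬ s ≤ t := fun h => by
        have : t ∈ S.filter (s ≤ ·) := by simp [ht, h]
        simp [hS] at this
      rw [hW.eq_zero _ _ (not_le.1 this), zero_mul]

/-- Back substitution in a triangular system with unit diagonal. A new minimum `a` does not enter
the equations of later elements, and its own equation determines `v a`, which is nonnegative by
`sum_le_one`. -/
theorem exists_dual (hW : IsOccupancyKernel W) (S : Finset ι) :
    ∃ v : ι → ℝ, (∀ t, 0 ≤ v t) ∧ ∀ s ∈ S, ∑ t ∈ S, W s t * v t = 1 := by
  induction S using Finset.induction_on_min with
  | empty => exact ⟨0, fun _ => le_rfl, by simp⟩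
  | insert a S ha ih =>
    obtain ⟨v, hv0, hv⟩ := ih
    have haS : a ∉ S := fun h => lt_irrefl _ (ha a h)
    refine ⟨Function.update v a (1 - ∑ t ∈ S, W a t * v t), fun t => ?_, fun s hs => ?_⟩
    · by_cases h : t = a
      · subst h
        rw [Function.update_self]
        have := hW.sum_le_one hv hv0 t
        linarith
      · rw [Function.update_of_ne h]
        exact hv0 t
    · have hsum : ∑ t ∈ S, W s t * Function.update v a (1 - ∑ t ∈ S, W a t * v t) t =
          ∑ t ∈ S, W s t * v t := by
        refine Finset.sum_congr rfl fun t ht => ?_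
        rw [Function.update_of_ne (by rintro rfl; exact haS ht)]
      rw [Finset.sum_insert haS, hsum, Function.update_self]
      rcases Finset.mem_insert.1 hs with rfl | hs
      · rw [hW.diag]; ring
      · rw [hv s hs, hW.eq_zero _ _ (ha s hs)]; ring

/-- A fractional use `y` of a single unit that exhausts it at all times in `S` uses it at least
`1 / C` times as much as any use `o` of `C` units does at the times in `S`. -/
theorem sum_le_mul_sum [Fintype ι] (hW : IsOccupancyKernel W) {S : Finset ι} {y o : ι → ℝ} {C : ℝ}
    (hC : 0 ≤ C) (hy0 : ∀ t, 0 ≤ y t) (hy : ∀ t ∈ S, ∑ s, W s t * y s = 1)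
    (ho0 : ∀ t, 0 ≤ o t) (ho : ∀ t, ∑ s, W s t * o s ≤ C) :
    ∑ t ∈ S, o t ≤ C * ∑ t, y t := by
  obtain ⟨v, hv0, hv⟩ := hW.exists_dual S
  -- Weak duality: `v` prices the capacity at the times in `S`. The use `o` pays at most `C * ∑ v`,
  -- while `y`, tight on `S`, pays exactly `∑ v`, which is at most its total mass.
  calc ∑ s ∈ S, o s = ∑ s ∈ S, ∑ t ∈ S, v t * (W s t * o s) := by
        refine Finset.sum_congr rfl fun s hs => ?_
        conv_lhs => rw [← mul_one (o s), ← hv s hs, Finset.mul_sum]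
        exact Finset.sum_congr rfl fun t _ => by ring
    _ = ∑ t ∈ S, v t * ∑ s ∈ S, W s t * o s := by
        rw [Finset.sum_comm]
        exact Finset.sum_congr rfl fun t _ => by rw [Finset.mul_sum]
    _ ≤ ∑ t ∈ S, v t * C := by
        refine Finset.sum_le_sum fun t _ => mul_le_mul_of_nonneg_left (le_trans ?_ (ho t)) (hv0 t)
        exact Finset.sum_le_sum_of_subset_of_nonneg (Finset.subset_univ _)
          fun s _ _ => mul_nonneg (hW.nonneg _ _) (ho0 s)
    _ = ∑ t ∈ S, C * ∑ s, v t * (W s t * y s) := by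
        refine Finset.sum_congr rfl fun t ht => ?_
        rw [← Finset.mul_sum, hy t ht]; ring
    _ = C * ∑ s, y s * ∑ t ∈ S, W s t * v t := by
        rw [← Finset.mul_sum, Finset.sum_comm]
        congr 1
        refine Finset.sum_congr rfl fun s _ => ?_
        rw [Finset.mul_sum]
        exact Finset.sum_congr rfl fun t _ => by ring
    _ ≤ C * ∑ s, y s := by
        refine mul_le_mul_of_nonneg_left (Finset.sum_le_sum fun s _ => ?_) hC
        exact mul_le_of_le_one_right (hy0 s) (hW.sum_le_one hv hv0 s)

end IsOccupancyKernel

/-! ### The fluid guide at a single arrival -/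

variable {R : Resources}

theorem price_le_price {p q : R.Item} (h : q.1 = p.1) (hle : (q.2 : ℕ) ≤ (p.2 : ℕ)) :
    price q ≤ price p := by
  obtain ⟨i, k⟩ := p
  obtain ⟨j, l⟩ := q
  obtain rfl : j = i := h
  simp only [price]
  have : (((l : ℕ) : ℝ) + 1) / R.cap j ≤ (((k : ℕ) : ℝ) + 1) / R.cap j := by
    have : ((l : ℕ) : ℝ) ≤ ((k : ℕ) : ℝ) := by exact_mod_cast hle
    gcongr
  gcongr

theorem price_nonneg (p : R.Item) : 0 ≤ price p := by
  refine mul_nonneg (NNReal.coe_nonneg _) (sub_nonneg.2 (Real.exp_le_one_iff.2 ?_))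
  rw [neg_nonpos]
  positivity

theorem exists_mem_topItems {nbrs : Finset (Fin R.n)} {rem : R.Item → ℝ} {q : R.Item}
    (hq : q.1 ∈ nbrs) (hr : 0 < rem q) :
    ∃ p ∈ topItems nbrs rem, p.1 = q.1 ∧ (q.2 : ℕ) ≤ p.2 := by
  classical
  obtain ⟨p, hp, hmax⟩ := Finset.exists_max_image
    (Finset.univ.filter fun p : R.Item => p.1 = q.1 ∧ 0 < rem p) (fun p => (p.2 : ℕ))
    ⟨q, by simp [hr]⟩
  simp only [Finset.mem_filter, Finset.mem_univ, true_and] at hp hmax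
  refine ⟨p, ?_, hp.1, hmax q ⟨rfl, hr⟩⟩
  simp only [topItems, Finset.mem_filter, Finset.mem_univ, true_and]
  exact ⟨hp.1 ▸ hq, hp.2, fun q' h h' => hmax q' ⟨h.trans hp.1, h'⟩⟩

/-- Prices increase with the rank, so maximality among the top units extends to all units that
remain. -/
theorem price_le_of_mem_bestItems {nbrs : Finset (Fin R.n)} {rem : R.Item → ℝ} {z q : R.Item}
    (hz : z ∈ bestItems nbrs rem) (hq : q.1 ∈ nbrs) (hr : 0 < rem q) : price q ≤ price z := by
  obtain ⟨p, hp, h1, h2⟩ := exists_mem_topItems hq hr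
  exact (price_le_price h1.symm h2).trans ((Finset.mem_filter.1 hz).2 p hp)

theorem bestItems_nonempty {nbrs : Finset (Fin R.n)} {rem : R.Item → ℝ} {q : R.Item}
    (hq : q.1 ∈ nbrs) (hr : 0 < rem q) : (bestItems nbrs rem).Nonempty := by
  classical
  obtain ⟨p, hp, -, -⟩ := exists_mem_topItems hq hr
  obtain ⟨z, hz, hmax⟩ := Finset.exists_max_image (topItems nbrs rem) price ⟨p, hp⟩
  exact ⟨z, Finset.mem_filter.2 ⟨hz, hmax⟩⟩

/-- What holds throughout the inner loop of the guide. -/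
structure IsPartialGuide (nbrs : Finset (Fin R.n)) (avail y : R.Item → ℝ) : Prop where
  nonneg : ∀ p, 0 ≤ y p
  le : ∀ p, y p ≤ avail p
  sum_le : ∑ p, y p ≤ 1
  eq_zero : ∀ p, p.1 ∉ nbrs → y p = 0
  price_le : ∀ p q, 0 < y p → q.1 ∈ nbrs → y q < avail q → price q ≤ price p

open Classical in
/-- The units that the guide can still match to the arrival. -/
def openItems (nbrs : Finset (Fin R.n)) (avail y : R.Item → ℝ) : Finset R.Item :=
  Finset.univ.filter fun q => q.1 ∈ nbrs ∧ y q < avail q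

theorem sum_update_add {α : Type*} [Fintype α] [DecidableEq α] (y : α → ℝ) (z : α) (m : ℝ) :
    ∑ p, Function.update y z (y z + m) p = ∑ p, y p + m := by
  rw [Finset.sum_update_of_mem (Finset.mem_univ z), ← Finset.add_sum_erase _ y (Finset.mem_univ z),
    Finset.sdiff_singleton_eq_erase]
  ring

theorem guideStep_of_not_lt (tb : TieBreak R.Item) (nbrs : Finset (Fin R.n)) (avail : R.Item → ℝ)
    {y : R.Item → ℝ} (h : ¬ ∑ p, y p < 1) : guideStep tb nbrs avail y = y :=
  dif_neg fun hc => h hc.1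

/-- Units never reopen within the loop, so the price comparison persists for units filled earlier,
and the unit filled now has the maximal price among all open ones. The minimum in the step decides
whether the arrival is saturated or the unit is closed. -/
theorem IsPartialGuide.guideStep {nbrs : Finset (Fin R.n)} {avail y : R.Item → ℝ}
    (h : IsPartialGuide nbrs avail y) (tb : TieBreak R.Item) :
    IsPartialGuide nbrs avail (guideStep tb nbrs avail y) ∧
      (∑ p, Resources.guideStep tb nbrs avail y p = 1 ∨
        (openItems nbrs avail (Resources.guideStep tb nbrs avail y)).card ≤
          (openItems nbrs avail y).card - 1) := by
  classical
  by_cases hc : ∑ p, y p < 1 ∧ (bestItems nbrs fun p => avail p - y p).Nonempty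
  · obtain ⟨hlt, hne⟩ := hc
    set z := tb.pick _ hne with hz
    have hzb : z ∈ bestItems nbrs fun p => avail p - y p := tb.pick_mem _ hne
    have hzt := (Finset.mem_filter.1 hzb).1
    simp only [topItems, Finset.mem_filter, Finset.mem_univ, true_and] at hzt
    obtain ⟨hzn, hzr, -⟩ := hzt
    set m := min (avail z - y z) (1 - ∑ p, y p) with hm
    have hstep : Resources.guideStep tb nbrs avail y = Function.update y z (y z + m) := by
      unfold Resources.guideStep
      simp only [hlt, hne, and_self, dite_true]
      congr!
    have hm0 : 0 < m := lt_min hzr (by linarith)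
    have hle : ∀ p, y p ≤ Function.update y z (y z + m) p := fun p => by
      by_cases hp : p = z
      · subst hp; rw [Function.update_self]; linarith
      · rw [Function.update_of_ne hp]
    have hsum := sum_update_add y z m
    rw [hstep]
    refine ⟨⟨fun p => (h.nonneg p).trans (hle p), fun p => ?_, ?_, fun p hp => ?_,
      fun p q hp hqn hq => ?_⟩, ?_⟩
    · by_cases hp : p = z
      · subst hp
        rw [Function.update_self]
        have := min_le_left (avail z - y z) (1 - ∑ p, y p)
        linarith
      · rw [Function.update_of_ne hp]
        exact h.le p
    · rw [hsum]
      have := min_le_right (avail z - y z) (1 - ∑ p, y p)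
      linarith
    · rw [Function.update_of_ne (by rintro rfl; exact hp hzn)]
      exact h.eq_zero p hp
    · have hq' : y q < avail q := (hle q).trans_lt hq
      by_cases hpz : p = z
      · rw [hpz]
        exact price_le_of_mem_bestItems hzb hqn (by linarith)
      · rw [Function.update_of_ne hpz] at hp
        exact h.price_le p q hp hqn hq'
    · rcases min_choice (avail z - y z) (1 - ∑ p, y p) with h1 | h1
      · right
        refine (Finset.card_le_card (t := (openItems nbrs avail y).erase z) fun q hq => ?_).trans
          (Finset.card_erase_of_mem ?_).le
        · simp only [openItems, Finset.mem_filter, Finset.mem_univ, true_and] at hq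
          rw [Finset.mem_erase]
          simp only [openItems, Finset.mem_filter, Finset.mem_univ, true_and]
          refine ⟨?_, hq.1, (hle q).trans_lt hq.2⟩
          rintro rfl
          rw [Function.update_self, hm, h1] at hq
          linarith [hq.2]
        · simp only [openItems, Finset.mem_filter, Finset.mem_univ, true_and]
          exact ⟨hzn, by linarith⟩
      · left
        rw [hsum, hm, h1]
        ring
  · have hstep : Resources.guideStep tb nbrs avail y = y := dif_neg hc
    rw [hstep]
    refine ⟨h, ?_⟩
    by_cases hlt : ∑ p, y p < 1
    -- An unsaturated arrival is stuck only when no unit is open; both sides are then `0`, by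
    -- truncated subtraction.
    · right
      have : openItems nbrs avail y = ∅ := by
        refine Finset.eq_empty_of_forall_notMem fun q hq => hc ⟨hlt, ?_⟩
        simp only [openItems, Finset.mem_filter, Finset.mem_univ, true_and] at hq
        exact bestItems_nonempty hq.1 (by linarith [hq.2])
      simp [this]
    · exact Or.inl (le_antisymm h.sum_le (not_lt.1 hlt))

theorem IsPartialGuide.iterate (tb : TieBreak R.Item) {nbrs : Finset (Fin R.n)}
    {avail : R.Item → ℝ} (havail : ∀ p, 0 ≤ avail p) (n : ℕ) :
    IsPartialGuide nbrs avail ((Resources.guideStep tb nbrs avail)^[n] 0) ∧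
      (∑ p, (Resources.guideStep tb nbrs avail)^[n] 0 p = 1 ∨
        (openItems nbrs avail ((Resources.guideStep tb nbrs avail)^[n] 0)).card ≤
          Fintype.card R.Item - n) := by
  induction n with
  | zero =>
    refine ⟨⟨fun _ => le_rfl, havail, by simp, fun _ _ => rfl, fun p q hp => ?_⟩,
      Or.inr (Finset.card_le_univ _)⟩
    simp at hp
  | succ n ih =>
    rw [Function.iterate_succ_apply']
    obtain ⟨h1, h2⟩ := ih
    obtain ⟨h3, h4⟩ := h1.guideStep tb
    refine ⟨h3, ?_⟩
    rcases h2 with h2 | h2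
    · left
      rw [guideStep_of_not_lt tb nbrs avail h2.not_lt, h2]
    · exact h4.imp id fun h => by omega

theorem IsPartialGuide.iterate_card (tb : TieBreak R.Item) {nbrs : Finset (Fin R.n)}
    {avail : R.Item → ℝ} (havail : ∀ p, 0 ≤ avail p) :
    ∑ p, (Resources.guideStep tb nbrs avail)^[Fintype.card R.Item] 0 p = 1 ∨
      ∀ q : R.Item, q.1 ∈ nbrs →
        avail q ≤ (Resources.guideStep tb nbrs avail)^[Fintype.card R.Item] 0 q := by
  refine (IsPartialGuide.iterate tb havail (Fintype.card R.Item)).2.imp id fun h q hq => ?_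
  rw [Nat.sub_self, Nat.le_zero, Finset.card_eq_zero] at h
  by_contra hlt
  have : q ∈ openItems nbrs avail
      ((Resources.guideStep tb nbrs avail)^[Fintype.card R.Item] 0) := by
    simp only [openItems, Finset.mem_filter, Finset.mem_univ, true_and]
    exact ⟨hq, not_le.1 hlt⟩
  rw [h] at this
  exact Finset.notMem_empty _ this

end

section

/-! ### The fluid guide on a sequence of arrivals -/

variable {R : Resources} {T : ℕ}

theorem cdf_nonneg (i : Fin R.n) (x : ℝ) : 0 ≤ R.cdf i x := NNReal.coe_nonneg _

theorem cdf_le_one (i : Fin R.n) (x : ℝ) : R.cdf i x ≤ 1 := by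
  exact_mod_cast (R.usage i).apply_le_one _

theorem cdf_mono (i : Fin R.n) : Monotone (R.cdf i) := fun x y h => by
  have : Set.Iic (ENNReal.ofReal x) ⊆ Set.Iic (ENNReal.ofReal y) :=
    Set.Iic_subset_Iic.2 (ENNReal.ofReal_le_ofReal h)
  exact_mod_cast (R.usage i).apply_mono this

/-- The probability that a unit of `i` that is matched at `s` has not returned by the arrival
of `t`; by convention `1` for `s = t` and `0` for later `s`. -/
def occupancy (arr : Fin T → R.Arrival) (i : Fin R.n) (s t : Fin T) : ℝ :=
  if s < t then 1 - R.cdf i ((arr t).time - (arr s).time) else if s = t then 1 else 0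

theorem occupancy_of_lt {arr : Fin T → R.Arrival} {i : Fin R.n} {s t : Fin T} (h : s < t) :
    occupancy arr i s t = 1 - R.cdf i ((arr t).time - (arr s).time) := if_pos h

theorem isOccupancyKernel {arr : Fin T → R.Arrival} (hm : Monotone fun t => (arr t).time)
    (i : Fin R.n) : IsOccupancyKernel (occupancy arr i) where
  nonneg s t := by
    unfold occupancy
    have := cdf_le_one i ((arr t).time - (arr s).time)
    split_ifs <;> linarith
  diag t := by simp [occupancy]
  eq_zero s t h := by simp [occupancy, h.not_gt, h.ne']
  mono s s' t h h' := by
    rcases h'.eq_or_lt with rfl | h'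
    · unfold occupancy
      have := cdf_nonneg i ((arr s').time - (arr s).time)
      simp only [lt_irrefl, if_false, if_true]
      split_ifs <;> linarith
    · rw [occupancy_of_lt h', occupancy_of_lt (h.trans_lt h')]
      have := cdf_mono i (sub_le_sub_left (hm h) (arr t).time)
      linarith

theorem sum_castLE_eq (t : Fin T) (f : Fin T → ℝ) :
    ∑ s : Fin t, f (Fin.castLE t.isLt.le s) = ∑ s, if s < t then f s else 0 := by
  rw [← Finset.sum_filter]
  refine Finset.sum_bij (fun s _ => Fin.castLE t.isLt.le s) (fun s _ => ?_) (fun s _ s' _ h => ?_)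
    (fun s hs => ?_) fun _ _ => rfl
  · simp only [Finset.mem_filter, Finset.mem_univ, true_and]
    exact s.isLt
  · exact Fin.castLE_injective _ h
  · simp only [Finset.mem_filter, Finset.mem_univ, true_and] at hs
    exact ⟨⟨s, hs⟩, Finset.mem_univ _, rfl⟩

theorem sum_occupancy_mul (arr : Fin T → R.Arrival) (i : Fin R.n) (t : Fin T) (f : Fin T → ℝ) :
    ∑ s, occupancy arr i s t * f s =
      ∑ s : Fin t, (1 - R.cdf i ((arr t).time - (arr (Fin.castLE t.isLt.le s)).time)) *
        f (Fin.castLE t.isLt.le s) + f t := by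
  rw [sum_castLE_eq t fun s => (1 - R.cdf i ((arr t).time - (arr s).time)) * f s]
  have : f t = ∑ s, if s = t then f s else 0 := by simp
  rw [this, ← Finset.sum_add_distrib]
  refine Finset.sum_congr rfl fun s _ => ?_
  unfold occupancy
  by_cases h : s < t
  · simp [h, h.ne]
  · by_cases h' : s = t <;> simp [h, h']

/-- The fraction of each unit that is available to the guide at arrival `t`. -/
def guideAvail (tb : TieBreak R.Item) (arr : Fin T → R.Arrival) (t : Fin T) (p : R.Item) : ℝ :=
  1 - ∑ s : Fin t,
    (1 - R.cdf p.1 ((arr t).time - (arr (Fin.castLE t.isLt.le s)).time)) *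
      guide tb arr (Fin.castLE t.isLt.le s) p

theorem guide_eq (tb : TieBreak R.Item) (arr : Fin T → R.Arrival) (t : Fin T) :
    guide tb arr t =
      (guideStep tb (arr t).nbrs (guideAvail tb arr t))^[Fintype.card R.Item] 0 := by
  rw [guide]
  rfl

/-- The kernel counts the match at `t` itself, the availability upon arrival does not. In this form
`guide ≤ guideAvail` says that the occupancy just after `t` is at most one, with equality exactly
when the unit is exhausted. -/
theorem guideAvail_eq (tb : TieBreak R.Item) (arr : Fin T → R.Arrival) (t : Fin T) (p : R.Item) :
    guideAvail tb arr t p =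
      1 + guide tb arr t p - ∑ s, occupancy arr p.1 s t * guide tb arr s p := by
  rw [sum_occupancy_mul arr p.1 t fun s => guide tb arr s p, guideAvail]
  ring

/-- Between consecutive arrivals fluid only returns, so at least what the previous arrival left over
is available. -/
theorem guideAvail_nonneg (tb : TieBreak R.Item) {arr : Fin T → R.Arrival}
    (hm : Monotone fun t => (arr t).time) (t : Fin T) (p : R.Item) :
    0 ≤ guideAvail tb arr t p := by
  obtain ⟨t, ht⟩ := t
  induction t using Nat.strong_induction_on generalizing p with
  | _ t ih =>
    have hguide : ∀ s (hs : s < t), IsPartialGuide (arr ⟨s, hs.trans ht⟩).nbrs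
        (guideAvail tb arr ⟨s, hs.trans ht⟩) (guide tb arr ⟨s, hs.trans ht⟩) := fun s hs => by
      rw [guide_eq]
      exact (IsPartialGuide.iterate tb (fun p => ih s hs p (hs.trans ht)) _).1
    rcases t with _ | t
    · simp [guideAvail]
    · have hle := (hguide t t.lt_succ_self).le p
      rw [guideAvail_eq] at hle
      have : ∑ s : Fin (t + 1), (1 - R.cdf p.1 ((arr ⟨t + 1, ht⟩).time -
            (arr (Fin.castLE ht.le s)).time)) * guide tb arr (Fin.castLE ht.le s) p ≤
          ∑ s, occupancy arr p.1 s ⟨t, t.lt_succ_self.trans ht⟩ * guide tb arr s p := by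
        rw [sum_castLE_eq ⟨t + 1, ht⟩ fun s => (1 - R.cdf p.1 ((arr ⟨t + 1, ht⟩).time -
            (arr s).time)) * guide tb arr s p]
        refine Finset.sum_le_sum fun s _ => ?_
        split_ifs with hs
        · refine mul_le_mul_of_nonneg_right ?_ ((hguide s hs).nonneg p)
          rcases (Nat.lt_succ_iff.1 hs).eq_or_lt with hs' | hs'
          · have : s = ⟨t, t.lt_succ_self.trans ht⟩ := Fin.ext hs'
            rw [← this, (isOccupancyKernel hm p.1).diag]
            linarith [cdf_nonneg p.1 ((arr ⟨t + 1, ht⟩).time - (arr s).time)]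
          · rw [occupancy_of_lt (show s < ⟨t, t.lt_succ_self.trans ht⟩ from hs')]
            have h1 : (arr ⟨t, t.lt_succ_self.trans ht⟩).time ≤ (arr ⟨t + 1, ht⟩).time :=
              hm (Fin.mk_le_mk.2 t.le_succ)
            have := cdf_mono p.1 (sub_le_sub_right h1 (arr s).time)
            linarith
        · rcases lt_or_eq_of_le (not_lt.1 hs) with h | h
          · rw [(isOccupancyKernel hm p.1).eq_zero, zero_mul]
            exact lt_of_le_of_lt (Fin.mk_le_mk.2 t.le_succ) h
          · rw [(isOccupancyKernel hm p.1).eq_zero, zero_mul]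
            rw [← h]
            exact Fin.mk_lt_mk.2 t.lt_succ_self
      unfold guideAvail
      linarith

theorem isPartialGuide_guide (tb : TieBreak R.Item) {arr : Fin T → R.Arrival}
    (hm : Monotone fun t => (arr t).time) (t : Fin T) :
    IsPartialGuide (arr t).nbrs (guideAvail tb arr t) (guide tb arr t) := by
  rw [guide_eq]
  exact (IsPartialGuide.iterate tb (guideAvail_nonneg tb hm t) _).1

theorem sum_guide_eq_one_or (tb : TieBreak R.Item) {arr : Fin T → R.Arrival}
    (hm : Monotone fun t => (arr t).time) (t : Fin T) :
    ∑ p, guide tb arr t p = 1 ∨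
      ∀ q : R.Item, q.1 ∈ (arr t).nbrs → guideAvail tb arr t q ≤ guide tb arr t q := by
  rw [guide_eq]
  exact IsPartialGuide.iterate_card tb (guideAvail_nonneg tb hm t)

theorem sum_occupancy_mul_guide_le_one (tb : TieBreak R.Item) {arr : Fin T → R.Arrival}
    (hm : Monotone fun t => (arr t).time) (t : Fin T) (p : R.Item) :
    ∑ s, occupancy arr p.1 s t * guide tb arr s p ≤ 1 := by
  have := (isPartialGuide_guide tb hm t).le p
  rw [guideAvail_eq] at this
  linarith

/-- The guide is itself online. Hence SAMPLE, which runs it on initial segments, can be analysed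
with a single guide on the whole sequence. -/
theorem guide_castLE (tb : TieBreak R.Item) {T' : ℕ} (h : T' ≤ T) (arr : Fin T → R.Arrival)
    (s : Fin T') :
    guide tb (fun s => arr (Fin.castLE h s)) s = guide tb arr (Fin.castLE h s) := by
  obtain ⟨s, hs⟩ := s
  induction s using Nat.strong_induction_on with
  | _ s ih =>
    rw [guide_eq, guide_eq]
    congr 2
    funext p
    unfold guideAvail
    congr 1
    refine Finset.sum_congr rfl fun r _ => ?_
    exact congrArg₂ _ rfl (congrFun (ih r r.isLt (r.isLt.trans hs)) p)

theorem guideMatch_initialArrivals (tb : TieBreak R.Item) (arr : Fin T → R.Arrival) (t : Fin T)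
    (i : Fin R.n) :
    guideMatch tb (initialArrivals arr t) (Fin.last t) i = guideMatch tb arr t i := by
  unfold guideMatch initialArrivals
  rw [guide_castLE tb t.isLt arr (Fin.last t)]
  rfl

theorem guideMatch_nonneg (tb : TieBreak R.Item) {arr : Fin T → R.Arrival}
    (hm : Monotone fun t => (arr t).time) (t : Fin T) (i : Fin R.n) : 0 ≤ guideMatch tb arr t i :=
  Finset.sum_nonneg fun _ _ => (isPartialGuide_guide tb hm t).nonneg _

theorem sum_guideMatch_le_one (tb : TieBreak R.Item) {arr : Fin T → R.Arrival}
    (hm : Monotone fun t => (arr t).time) (t : Fin T) : ∑ i, guideMatch tb arr t i ≤ 1 := by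
  have := (isPartialGuide_guide tb hm t).sum_le
  rwa [Fintype.sum_sigma] at this

theorem guideMatch_eq_zero (tb : TieBreak R.Item) {arr : Fin T → R.Arrival}
    (hm : Monotone fun t => (arr t).time) {t : Fin T} {i : Fin R.n} (hi : i ∉ (arr t).nbrs) :
    guideMatch tb arr t i = 0 :=
  Finset.sum_eq_zero fun _ _ => (isPartialGuide_guide tb hm t).eq_zero _ hi

theorem sum_occupancy_mul_guideMatch_le (tb : TieBreak R.Item) {arr : Fin T → R.Arrival}
    (hm : Monotone fun t => (arr t).time) (t : Fin T) (i : Fin R.n) :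
    ∑ s, occupancy arr i s t * guideMatch tb arr s i ≤ R.cap i := by
  simp only [guideMatch, Finset.mul_sum]
  rw [Finset.sum_comm]
  calc ∑ k : Fin (R.cap i), ∑ s, occupancy arr i s t * guide tb arr s ⟨i, k⟩
      ≤ ∑ k : Fin (R.cap i), 1 :=
        Finset.sum_le_sum fun k _ => sum_occupancy_mul_guide_le_one tb hm t ⟨i, k⟩
    _ = R.cap i := by simp

/-! ### The guide against any fluid-feasible matching -/

open Classical in
/-- The rank of the highest unit of `i` that remains partly unmatched after arrival `t`, or `0`. -/
def topRank (tb : TieBreak R.Item) (arr : Fin T → R.Arrival) (i : Fin R.n) (t : Fin T) : ℕ :=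
  (Finset.univ.filter fun k : Fin (R.cap i) =>
    guide tb arr t ⟨i, k⟩ < guideAvail tb arr t ⟨i, k⟩).sup fun k => (k : ℕ) + 1

theorem topRank_le (tb : TieBreak R.Item) (arr : Fin T → R.Arrival) (i : Fin R.n) (t : Fin T) :
    topRank tb arr i t ≤ R.cap i :=
  Finset.sup_le fun k _ => k.isLt

/-- The index `k` has rank `k + 1`, so the hypothesis places the unit strictly above the top rank.
This is the tightness that `sum_le_mul_sum` requires. -/
theorem sum_occupancy_mul_guide_eq_one (tb : TieBreak R.Item) {arr : Fin T → R.Arrival}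
    (hm : Monotone fun t => (arr t).time) {i : Fin R.n} {t : Fin T} {k : Fin (R.cap i)}
    (hk : topRank tb arr i t ≤ k) :
    ∑ s, occupancy arr i s t * guide tb arr s ⟨i, k⟩ = 1 := by
  classical
  have hle := (isPartialGuide_guide tb hm t).le ⟨i, k⟩
  have hge : ¬ guide tb arr t ⟨i, k⟩ < guideAvail tb arr t ⟨i, k⟩ := fun h => by
    have : (k : ℕ) + 1 ≤ topRank tb arr i t :=
      Finset.le_sup (f := fun k : Fin (R.cap i) => (k : ℕ) + 1) (by simp [h])
    omega
  have := guideAvail_eq tb arr t ⟨i, k⟩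
  simp only at this
  linarith [le_antisymm hle (not_lt.1 hge)]

/-- If a unit of `i` is left over, the arrival was saturated, at prices no lower than that of this
unit. If none is, the rank is `0` and the left side vanishes. -/
theorem reward_mul_le_sum_guide_mul_price (tb : TieBreak R.Item) {arr : Fin T → R.Arrival}
    (hm : Monotone fun t => (arr t).time) {i : Fin R.n} {t : Fin T} (hi : i ∈ (arr t).nbrs) :
    R.reward i * (1 - Real.exp (-((topRank tb arr i t : ℝ) / R.cap i))) ≤
      ∑ p, guide tb arr t p * price p := by
  classical
  have hg := isPartialGuide_guide tb hm t
  by_cases h : (Finset.univ.filter fun k : Fin (R.cap i) =>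
    guide tb arr t ⟨i, k⟩ < guideAvail tb arr t ⟨i, k⟩).Nonempty
  · obtain ⟨k, hk, hk'⟩ := Finset.exists_mem_eq_sup _ h fun k => (k : ℕ) + 1
    simp only [Finset.mem_filter, Finset.mem_univ, true_and] at hk
    have hsum : ∑ p, guide tb arr t p = 1 :=
      (sum_guide_eq_one_or tb hm t).resolve_right fun h => absurd (h ⟨i, k⟩ hi) (not_le.2 hk)
    have htop : topRank tb arr i t = (k : ℕ) + 1 := by
      rw [← hk']
      unfold topRank
      congr!
    have hprice : R.reward i * (1 - Real.exp (-((topRank tb arr i t : ℝ) / R.cap i))) =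
        ∑ p, guide tb arr t p * price (⟨i, k⟩ : R.Item) := by
      rw [← Finset.sum_mul, hsum, one_mul, htop]
      simp [price]
    rw [hprice]
    refine Finset.sum_le_sum fun p _ => ?_
    rcases (hg.nonneg p).eq_or_lt with hp | hp
    · rw [← hp, zero_mul, zero_mul]
    · exact mul_le_mul_of_nonneg_left (hg.price_le p _ hp hi hk) hp.le
  · rw [Finset.not_nonempty_iff_eq_empty] at h
    have htop : topRank tb arr i t = 0 := by
      unfold topRank
      simp [h]
    simp only [htop, Nat.cast_zero, zero_div, neg_zero, Real.exp_zero, sub_self, mul_zero]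
    exact Finset.sum_nonneg fun p _ => mul_nonneg (hg.nonneg p) (price_nonneg p)

/-- A telescoping sum over the units above rank `z`, which makes it possible to exchange the roles
of arrivals and units. -/
theorem exp_sub_exp_neg_one_eq {c z : ℕ} (hc : 0 < c) (hz : z ≤ c) :
    Real.exp (-((z : ℝ) / c)) - Real.exp (-1) =
      (Real.exp (1 / c) - 1) *
        ∑ k : Fin c, if z ≤ k then Real.exp (-(((k : ℕ) + 1 : ℝ) / c)) else 0 := by
  have hc' : (c : ℝ) ≠ 0 := by positivity
  rw [Fin.sum_univ_eq_sum_range (fun k => if z ≤ k then Real.exp (-((k + 1 : ℝ) / c)) else 0) c,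
    ← Finset.sum_filter]
  have hf : (Finset.range c).filter (z ≤ ·) = Finset.Ico z c := by
    ext k; simp [and_comm]
  rw [hf, Finset.mul_sum]
  have : ∀ k ∈ Finset.Ico z c, (Real.exp (1 / c) - 1) * Real.exp (-((k + 1 : ℝ) / c)) =
      -(Real.exp (-(((k + 1 : ℕ) : ℝ) / c)) - Real.exp (-((k : ℝ) / c))) := fun k _ => by
    rw [sub_mul, ← Real.exp_add]
    have : 1 / (c : ℝ) + -((k + 1 : ℝ) / c) = -(k / c) := by ring
    rw [this]
    push_cast
    ring
  rw [Finset.sum_congr rfl this, Finset.sum_neg_distrib,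
    Finset.sum_Ico_sub (fun k : ℕ => Real.exp (-((k : ℝ) / c))) hz, div_self hc']
  ring

theorem mul_exp_inv_sub_one_le {c m : ℕ} (hm : 0 < m) (hc : m ≤ c) :
    (Real.exp (1 / c) - 1) * c ≤ 1 + 1 / (m : ℝ) := by
  have hc0 : (0 : ℝ) < c := by exact_mod_cast hm.trans_le hc
  have hm0 : (0 : ℝ) < m := by exact_mod_cast hm
  have hc1 : (1 : ℝ) ≤ c := by exact_mod_cast (Nat.succ_le_of_lt hm).trans hc
  have h1 : |1 / (c : ℝ)| ≤ 1 := by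
    rw [abs_of_pos (by positivity), div_le_one hc0]
    exact hc1
  have h2 := (abs_le.1 (Real.abs_exp_sub_one_sub_id_le h1)).2
  have h3 : (Real.exp (1 / c) - 1) * c ≤ (1 / (c : ℝ) + (1 / (c : ℝ)) ^ 2) * c :=
    mul_le_mul_of_nonneg_right (by linarith) hc0.le
  have h4 : (1 / (c : ℝ) + (1 / (c : ℝ)) ^ 2) * c = 1 + 1 / c := by field_simp
  have h5 : 1 / (c : ℝ) ≤ 1 / m := one_div_le_one_div_of_le hm0 (by exact_mod_cast hc)
  linarith

/-- After exchanging the sums, each unit `k` is charged the `o`-mass of the arrivals at which it is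
exhausted, which `sum_le_mul_sum` bounds with `C = c_i`. The factor `1 + 1/m` bounds `c * (exp (1/c)
- 1)`, the cost of integral ranks. -/
theorem sum_mul_exp_sub_le (tb : TieBreak R.Item) {arr : Fin T → R.Arrival}
    (hm : Monotone fun t => (arr t).time) {m : ℕ} (hm0 : 0 < m) (i : Fin R.n) (hi : m ≤ R.cap i)
    {o : Fin T → ℝ} (ho0 : ∀ t, 0 ≤ o t) (ho : ∀ t, ∑ s, occupancy arr i s t * o s ≤ R.cap i) :
    ∑ t, o t * (Real.exp (-((topRank tb arr i t : ℝ) / R.cap i)) - Real.exp (-1)) ≤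
      (1 + 1 / (m : ℝ)) * ∑ t, ∑ k : Fin (R.cap i),
        guide tb arr t ⟨i, k⟩ * Real.exp (-(((k : ℕ) + 1 : ℝ) / R.cap i)) := by
  classical
  have he : 0 ≤ Real.exp (1 / (R.cap i : ℝ)) - 1 :=
    sub_nonneg.2 (Real.one_le_exp (by positivity))
  calc ∑ t, o t * (Real.exp (-((topRank tb arr i t : ℝ) / R.cap i)) - Real.exp (-1))
      = (Real.exp (1 / R.cap i) - 1) * ∑ k : Fin (R.cap i),
          Real.exp (-(((k : ℕ) + 1 : ℝ) / R.cap i)) *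
            ∑ t ∈ Finset.univ.filter (fun t => topRank tb arr i t ≤ k), o t := by
        simp_rw [fun t => exp_sub_exp_neg_one_eq (R.cap_pos i) (topRank_le tb arr i t),
          Finset.sum_filter, Finset.mul_sum]
        rw [Finset.sum_comm]
        refine Finset.sum_congr rfl fun k _ => Finset.sum_congr rfl fun t _ => ?_
        split_ifs <;> ring
    _ ≤ (Real.exp (1 / R.cap i) - 1) * ∑ k : Fin (R.cap i),
          Real.exp (-(((k : ℕ) + 1 : ℝ) / R.cap i)) *
            (R.cap i * ∑ t, guide tb arr t ⟨i, k⟩) := by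
        refine mul_le_mul_of_nonneg_left (Finset.sum_le_sum fun k _ =>
          mul_le_mul_of_nonneg_left ?_ (Real.exp_nonneg _)) he
        refine (isOccupancyKernel hm i).sum_le_mul_sum (Nat.cast_nonneg _)
          (fun t => (isPartialGuide_guide tb hm t).nonneg _) (fun t ht => ?_) ho0 ho
        exact sum_occupancy_mul_guide_eq_one tb hm (Finset.mem_filter.1 ht).2
    _ = ((Real.exp (1 / R.cap i) - 1) * R.cap i) * ∑ t, ∑ k : Fin (R.cap i),
          guide tb arr t ⟨i, k⟩ * Real.exp (-(((k : ℕ) + 1 : ℝ) / R.cap i)) := by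
        rw [Finset.sum_comm]
        simp_rw [Finset.mul_sum]
        exact Finset.sum_congr rfl fun k _ => Finset.sum_congr rfl fun t _ => by ring
    _ ≤ _ := by
        refine mul_le_mul_of_nonneg_right (mul_exp_inv_sub_one_le hm0 hi) ?_
        exact Finset.sum_nonneg fun t _ => Finset.sum_nonneg fun k _ =>
          mul_nonneg ((isPartialGuide_guide tb hm t).nonneg _) (Real.exp_nonneg _)

/-- The guide collects almost `1 - 1 / e` of the reward of any matching `o` that satisfies the
capacity constraints in expectation. -/
theorem guide_competitive (tb : TieBreak R.Item) {arr : Fin T → R.Arrival}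
    (hm : Monotone fun t => (arr t).time) {m : ℕ} (hm0 : 0 < m) (hcap : ∀ i, m ≤ R.cap i)
    {o : Fin T → Fin R.n → ℝ} (ho0 : ∀ t i, 0 ≤ o t i) (ho1 : ∀ t, ∑ i, o t i ≤ 1)
    (hon : ∀ t i, i ∉ (arr t).nbrs → o t i = 0)
    (ho : ∀ t i, ∑ s, occupancy arr i s t * o s i ≤ R.cap i) :
    (1 - Real.exp (-1)) * ∑ t, ∑ i, R.reward i * o t i ≤
      (1 + 1 / (m : ℝ)) * ∑ t, ∑ i, R.reward i * guideMatch tb arr t i := by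
  -- The price part, charged arrival by arrival. The factor `1 + 1/m` is not needed here and only
  -- matches `h2`.
  have h1 : ∑ t, ∑ i, R.reward i * o t i *
      (1 - Real.exp (-((topRank tb arr i t : ℝ) / R.cap i))) ≤
        (1 + 1 / (m : ℝ)) * ∑ t, ∑ p, guide tb arr t p * price p := by
    have hlam : ∀ t, 0 ≤ ∑ p, guide tb arr t p * price p := fun t => Finset.sum_nonneg fun p _ =>
      mul_nonneg ((isPartialGuide_guide tb hm t).nonneg p) (price_nonneg p)
    refine le_trans (Finset.sum_le_sum fun t _ => ?_)
      (le_mul_of_one_le_left (Finset.sum_nonneg fun t _ => hlam t) ?_)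
    · calc ∑ i, R.reward i * o t i * (1 - Real.exp (-((topRank tb arr i t : ℝ) / R.cap i)))
          ≤ ∑ i, o t i * ∑ p, guide tb arr t p * price p := by
            refine Finset.sum_le_sum fun i _ => ?_
            by_cases hi : i ∈ (arr t).nbrs
            · have := mul_le_mul_of_nonneg_left (reward_mul_le_sum_guide_mul_price tb hm hi)
                (ho0 t i)
              linarith
            · simp [hon t i hi]
        _ ≤ _ := by
            rw [← Finset.sum_mul]
            exact mul_le_of_le_one_left (hlam t) (ho1 t)
    · have : 0 ≤ 1 / (m : ℝ) := by positivity
      linarith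
  -- The remaining part, charged resource by resource.
  have h2 : ∑ i, R.reward i *
      ∑ t, o t i * (Real.exp (-((topRank tb arr i t : ℝ) / R.cap i)) - Real.exp (-1)) ≤
        ∑ i, R.reward i * ((1 + 1 / (m : ℝ)) * ∑ t, ∑ k : Fin (R.cap i),
          guide tb arr t ⟨i, k⟩ * Real.exp (-(((k : ℕ) + 1 : ℝ) / R.cap i))) :=
    Finset.sum_le_sum fun i _ => mul_le_mul_of_nonneg_left
      (sum_mul_exp_sub_le tb hm hm0 i (hcap i) (fun t => ho0 t i) fun t => ho t i)
      (NNReal.coe_nonneg _)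
  have h3 : (1 - Real.exp (-1)) * ∑ t, ∑ i, (R.reward i : ℝ) * o t i =
      ∑ t, ∑ i, R.reward i * o t i * (1 - Real.exp (-((topRank tb arr i t : ℝ) / R.cap i))) +
      ∑ i, R.reward i *
        ∑ t, o t i * (Real.exp (-((topRank tb arr i t : ℝ) / R.cap i)) - Real.exp (-1)) := by
    simp_rw [Finset.mul_sum]
    rw [Finset.sum_comm (γ := Fin R.n) (s := Finset.univ) (t := Finset.univ) (f := fun i t =>
      (R.reward i : ℝ) *
        (o t i * (Real.exp (-((topRank tb arr i t : ℝ) / R.cap i)) - Real.exp (-1)))),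
      ← Finset.sum_add_distrib]
    refine Finset.sum_congr rfl fun t _ => ?_
    rw [← Finset.sum_add_distrib]
    exact Finset.sum_congr rfl fun i _ => by ring
  have h4 : ∑ t, ∑ i, (R.reward i : ℝ) * guideMatch tb arr t i =
      ∑ t, ∑ p, guide tb arr t p * price p +
      ∑ i, R.reward i * ∑ t, ∑ k : Fin (R.cap i),
          guide tb arr t ⟨i, k⟩ * Real.exp (-(((k : ℕ) + 1 : ℝ) / R.cap i)) := by
    simp_rw [Finset.mul_sum]
    rw [Finset.sum_comm (γ := Fin R.n), ← Finset.sum_add_distrib]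
    refine Finset.sum_congr rfl fun t _ => ?_
    rw [Fintype.sum_sigma, ← Finset.sum_add_distrib]
    refine Finset.sum_congr rfl fun i _ => ?_
    rw [← Finset.sum_add_distrib, guideMatch, Finset.mul_sum]
    exact Finset.sum_congr rfl fun k _ => by simp only [price]; ring
  rw [h3, h4, mul_add]
  refine add_le_add h1 (h2.trans (le_of_eq ?_))
  rw [Finset.mul_sum]
  exact Finset.sum_congr rfl fun i _ => by ring

end

section

/-! ### The law of the matches made by a policy -/

variable {R : Resources} {G : R.ArrivalSeq}

/-- The time between two arrivals. -/
def elapsed (G : R.ArrivalSeq) (s t : Fin G.T) : ℝ≥0∞ :=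
  ENNReal.ofReal ((G.arr t).time - (G.arr s).time)

theorem elapsed_mono_right (G : R.ArrivalSeq) (s : Fin G.T) {t t' : Fin G.T} (h : t ≤ t') :
    elapsed G s t ≤ elapsed G s t' :=
  ENNReal.ofReal_le_ofReal (sub_le_sub_right (G.mono h) _)

/-- The duration of the match made at an arrival, `⊤` if there is none. -/
def matchDuration (o : Option (Fin R.n)) (d : Fin R.n → ℝ≥0∞) : ℝ≥0∞ :=
  match o with
  | some i => d i
  | none => ⊤

/-- The match made at arrival `t`, as a function of the earlier matches. -/
def matchStep (G : R.ArrivalSeq) (P : R.Policy G.T) (u : Fin G.T → unitInterval)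
    (d : Fin G.T → Fin R.n → ℝ≥0∞) (t : Fin G.T) (past : Fin t → Option (Fin R.n)) :
    Option (Fin R.n) :=
  let el : Fin t → ℝ≥0∞ := fun s => elapsed G (Fin.castLE t.isLt.le s) t
  let dur : Fin t → ℝ≥0∞ := fun s => matchDuration (past s) (d (Fin.castLE t.isLt.le s))
  match P.choose t past (fun s => if dur s ≤ el s then dur s else ⊤)
      (fun s => u (Fin.castLE t.isLt s)) with
  | some i => if i ∈ (G.arr t).nbrs ∧
      (Finset.univ.filter fun s : Fin t => past s = some i ∧ el s < dur s).card < R.cap i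
      then some i else none
  | none => none

theorem matched_eq (P : R.Policy G.T) (u : Fin G.T → unitInterval)
    (d : Fin G.T → Fin R.n → ℝ≥0∞) (t : Fin G.T) :
    matched G P u d t =
      matchStep G P u d t fun s => matched G P u d (Fin.castLE t.isLt.le s) := by
  rw [matched]
  rfl

theorem matchStep_eq_some_iff {P : R.Policy G.T} {u : Fin G.T → unitInterval}
    {d : Fin G.T → Fin R.n → ℝ≥0∞} {t : Fin G.T} {past : Fin t → Option (Fin R.n)} {i : Fin R.n} :
    matchStep G P u d t past = some i ↔
      P.choose t past (fun s => if matchDuration (past s) (d (Fin.castLE t.isLt.le s)) ≤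
          elapsed G (Fin.castLE t.isLt.le s) t
        then matchDuration (past s) (d (Fin.castLE t.isLt.le s)) else ⊤)
        (fun s => u (Fin.castLE t.isLt s)) = some i ∧ i ∈ (G.arr t).nbrs ∧
      (Finset.univ.filter fun s : Fin t => past s = some i ∧
        elapsed G (Fin.castLE t.isLt.le s) t < d (Fin.castLE t.isLt.le s) i).card < R.cap i := by
  have hcard : ∀ j, (Finset.univ.filter fun s : Fin t => past s = some j ∧
      elapsed G (Fin.castLE t.isLt.le s) t <
        matchDuration (past s) (d (Fin.castLE t.isLt.le s))).card =
      (Finset.univ.filter fun s : Fin t => past s = some j ∧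
        elapsed G (Fin.castLE t.isLt.le s) t < d (Fin.castLE t.isLt.le s) j).card := fun j => by
    congr 1
    refine Finset.filter_congr fun s _ => and_congr_right fun h => ?_
    rw [h]
    rfl
  unfold matchStep
  dsimp only
  split
  · next j hj =>
    rw [hj, hcard]
    split_ifs with h
    · constructor
      · rintro ⟨⟩
        exact ⟨rfl, h⟩
      · exact fun h => h.1
    · constructor
      · rintro ⟨⟩
      · rintro ⟨⟨⟩, h'⟩
        exact absurd h' h
  · next hj =>
    rw [hj]
    constructor
    · rintro ⟨⟩
    · rintro ⟨⟨⟩, _⟩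

/-- The match at `t` does not depend on the durations from `t` on, nor on later seeds. -/
theorem matched_congr (P : R.Policy G.T) {u u' : Fin G.T → unitInterval}
    {d d' : Fin G.T → Fin R.n → ℝ≥0∞} {t : Fin G.T} (hu : ∀ s ≤ t, u s = u' s)
    (hd : ∀ s < t, d s = d' s) : matched G P u d t = matched G P u' d' t := by
  obtain ⟨t, ht⟩ := t
  induction t using Nat.strong_induction_on with
  | _ t ih =>
    rw [matched_eq, matched_eq]
    have h1 : (fun s : Fin t => matched G P u d (Fin.castLE ht.le s)) =
        fun s : Fin t => matched G P u' d' (Fin.castLE ht.le s) := by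
      funext s
      have hst : (Fin.castLE ht.le s) < ⟨t, ht⟩ := s.isLt
      exact ih s s.isLt (s.isLt.trans ht) (fun r hr => hu r (hr.trans hst.le))
        fun r hr => hd r (hr.trans hst)
    refine (congrArg (matchStep G P u d ⟨t, ht⟩) h1).trans ?_
    have h2 : ∀ s : Fin t, d (Fin.castLE ht.le s) = d' (Fin.castLE ht.le s) := fun s => hd _ s.isLt
    have h3 : ∀ s : Fin (t + 1), u (Fin.castLE ht s) = u' (Fin.castLE ht s) := fun s =>
      hu _ (Nat.lt_succ_iff.1 s.isLt)
    unfold matchStep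
    simp only [h2, h3]

/-! ### Measurability of the matches -/

theorem measurable_matchDuration (o : Option (Fin R.n)) :
    Measurable fun d : Fin R.n → ℝ≥0∞ => matchDuration o d := by
  rcases o with _ | i
  · exact measurable_const
  · exact measurable_pi_apply i

theorem measurableSet_lt_duration {T : ℕ} (a : ℝ≥0∞) (s : Fin T) (i : Fin R.n) :
    MeasurableSet {ω : (Fin T → unitInterval) × (Fin T → Fin R.n → ℝ≥0∞) | a < ω.2 s i} :=
  measurableSet_lt measurable_const (by fun_prop)

theorem measurableSet_matchStep_eq_some (P : R.Policy G.T) (t : Fin G.T)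
    (past : Fin t → Option (Fin R.n)) (i : Fin R.n) :
    MeasurableSet {ω : (Fin G.T → unitInterval) × (Fin G.T → Fin R.n → ℝ≥0∞) |
      matchStep G P ω.1 ω.2 t past = some i} := by
  simp only [matchStep_eq_some_iff]
  have hd : ∀ s : Fin t, Measurable fun ω : (Fin G.T → unitInterval) ×
      (Fin G.T → Fin R.n → ℝ≥0∞) => matchDuration (past s) (ω.2 (Fin.castLE t.isLt.le s)) :=
    fun s => (measurable_matchDuration _).comp ((measurable_pi_apply _).comp measurable_snd)
  refine MeasurableSet.inter ?_ (MeasurableSet.inter (MeasurableSet.const _) ?_)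
  · have h1 : Measurable fun ω : (Fin G.T → unitInterval) × (Fin G.T → Fin R.n → ℝ≥0∞) =>
        ((fun s => if matchDuration (past s) (ω.2 (Fin.castLE t.isLt.le s)) ≤
          elapsed G (Fin.castLE t.isLt.le s) t
        then matchDuration (past s) (ω.2 (Fin.castLE t.isLt.le s)) else ⊤ : Fin t → ℝ≥0∞),
        (fun s => ω.1 (Fin.castLE t.isLt s) : Fin ((t : ℕ) + 1) → unitInterval)) := by
      refine Measurable.prodMk (measurable_pi_lambda _ fun s => ?_)
        (measurable_pi_lambda _ fun s => (measurable_pi_apply _).comp measurable_fst)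
      exact Measurable.ite (measurableSet_le (hd s) measurable_const) (hd s) measurable_const
    exact h1 (P.measurable_choose t past i)
  · simp only [Finset.card_filter]
    have hs : ∀ s : Fin t, Measurable fun ω : (Fin G.T → unitInterval) ×
        (Fin G.T → Fin R.n → ℝ≥0∞) => if past s = some i ∧
          elapsed G (Fin.castLE t.isLt.le s) t < ω.2 (Fin.castLE t.isLt.le s) i
          then 1 else 0 := fun s =>
      Measurable.ite ((MeasurableSet.const _).inter
        (measurableSet_lt_duration _ _ _)) measurable_const measurable_const
    have hc : Measurable fun ω : (Fin G.T → unitInterval) × (Fin G.T → Fin R.n → ℝ≥0∞) =>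
        ∑ s : Fin t, if past s = some i ∧
          elapsed G (Fin.castLE t.isLt.le s) t < ω.2 (Fin.castLE t.isLt.le s) i
          then 1 else 0 := Finset.measurable_sum _ fun s _ => hs s
    exact measurableSet_lt hc measurable_const

theorem measurableSet_eq_of_eq_some {Ω : Type*} [MeasurableSpace Ω] {n : ℕ}
    {f : Ω → Option (Fin n)} (h : ∀ i, MeasurableSet {ω | f ω = some i}) (o : Option (Fin n)) :
    MeasurableSet {ω | f ω = o} := by
  rcases o with _ | i
  · have : {ω | f ω = none} = (⋃ i, {ω | f ω = some i})ᶜ := by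
      ext ω
      rcases h : f ω <;> simp [h]
    rw [this]
    exact (MeasurableSet.iUnion h).compl
  · exact h i

/-- Only finitely many pasts are possible, so the event splits into a finite union over them. -/
theorem measurableSet_matched_eq (P : R.Policy G.T) (t : Fin G.T) (o : Option (Fin R.n)) :
    MeasurableSet {ω : (Fin G.T → unitInterval) × (Fin G.T → Fin R.n → ℝ≥0∞) |
      matched G P ω.1 ω.2 t = o} := by
  obtain ⟨t, ht⟩ := t
  induction t using Nat.strong_induction_on generalizing o with
  | _ t ih =>
    have : {ω : (Fin G.T → unitInterval) × (Fin G.T → Fin R.n → ℝ≥0∞) |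
        matched G P ω.1 ω.2 ⟨t, ht⟩ = o} = ⋃ past : Fin t → Option (Fin R.n),
        ((⋂ s : Fin t, {ω | matched G P ω.1 ω.2 (Fin.castLE ht.le s) = past s}) ∩
          {ω | matchStep G P ω.1 ω.2 ⟨t, ht⟩ past = o}) := by
      ext ω
      simp only [Set.mem_ofPred_eq, Set.mem_iUnion, Set.mem_inter_iff, Set.mem_iInter]
      rw [matched_eq]
      constructor
      · exact fun h => ⟨_, fun _ => rfl, h⟩
      · rintro ⟨past, h1, h2⟩
        rw [← h2]
        congr 1
        exact funext h1
    rw [this]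
    refine MeasurableSet.iUnion fun past => MeasurableSet.inter
      (MeasurableSet.iInter fun s => ih s s.isLt (past s) (s.isLt.trans ht)) ?_
    exact measurableSet_eq_of_eq_some (measurableSet_matchStep_eq_some P ⟨t, ht⟩ past) o

instance isProbabilityMeasure_law (R : Resources) (T : ℕ) : IsProbabilityMeasure (law R T) := by
  unfold law
  infer_instance

/-- The probability that the policy matches arrival `t` to resource `i`. -/
def matchProb (G : R.ArrivalSeq) (P : R.Policy G.T) (t : Fin G.T) (i : Fin R.n) : ℝ :=
  (law R G.T).real {ω | matched G P ω.1 ω.2 t = some i}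

theorem matchReward_eq (o : Option (Fin R.n)) :
    matchReward o = ∑ i, if o = some i then (R.reward i : ℝ≥0∞) else 0 := by
  rcases o with _ | i <;> simp [matchReward]

theorem value_eq_ofReal (P : R.Policy G.T) :
    P.value G = ENNReal.ofReal (∑ t, ∑ i, R.reward i * matchProb G P t i) := by
  have hind : ∀ t i (ω : (Fin G.T → unitInterval) × (Fin G.T → Fin R.n → ℝ≥0∞)),
      (if matched G P ω.1 ω.2 t = some i then (R.reward i : ℝ≥0∞) else 0) =
      {ω : (Fin G.T → unitInterval) × (Fin G.T → Fin R.n → ℝ≥0∞) |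
        matched G P ω.1 ω.2 t = some i}.indicator (fun _ => (R.reward i : ℝ≥0∞)) ω :=
    fun t i ω => by simp [Set.indicator_apply]
  have hnn : ∀ t i, 0 ≤ (R.reward i : ℝ) * matchProb G P t i := fun t i =>
    mul_nonneg (NNReal.coe_nonneg _) measureReal_nonneg
  unfold Policy.value
  simp only [matchReward_eq, hind]
  rw [lintegral_finsetSum _ fun t _ => Finset.measurable_sum _ fun i _ =>
    measurable_const.indicator (measurableSet_matched_eq P t _),
    ENNReal.ofReal_sum_of_nonneg fun t _ => Finset.sum_nonneg fun i _ => hnn t i]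
  refine Finset.sum_congr rfl fun t _ => ?_
  rw [lintegral_finsetSum _ fun i _ => measurable_const.indicator (measurableSet_matched_eq P t _),
    ENNReal.ofReal_sum_of_nonneg fun i _ => hnn t i]
  refine Finset.sum_congr rfl fun i _ => ?_
  rw [lintegral_indicator_const (measurableSet_matched_eq P t _), matchProb,
    ENNReal.ofReal_mul (NNReal.coe_nonneg _), ofReal_measureReal, ENNReal.ofReal_coe_nnreal]

/-! ### Policies satisfy the fluid constraints -/

theorem sum_measureReal_le_of_card_le {Ω ι : Type*} [MeasurableSpace Ω] [Fintype ι]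
    {μ : Measure Ω} [IsProbabilityMeasure μ] {A : ι → Set Ω} (hA : ∀ i, MeasurableSet (A i))
    {c : ℕ} [∀ ω, DecidablePred fun i => ω ∈ A i]
    (h : ∀ ω, (Finset.univ.filter fun i => ω ∈ A i).card ≤ c) : ∑ i, μ.real (A i) ≤ c := by
  have h1 : ∑ i, μ (A i) ≤ c := by
    calc ∑ i, μ (A i) = ∫⁻ ω, ∑ i, (A i).indicator (fun _ => 1) ω ∂μ := by
          rw [lintegral_finsetSum _ fun i _ => measurable_const.indicator (hA i)]
          exact Finset.sum_congr rfl fun i _ => by rw [lintegral_indicator_const (hA i), one_mul]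
      _ ≤ ∫⁻ _, c ∂μ := lintegral_mono fun ω => by
          have : ∑ i, (A i).indicator (fun _ => (1 : ℝ≥0∞)) ω =
              ((Finset.univ.filter fun i => ω ∈ A i).card : ℝ≥0∞) := by
            rw [Finset.card_filter]
            push_cast
            exact Finset.sum_congr rfl fun i _ => by simp [Set.indicator_apply]
          rw [this]
          exact Nat.cast_le.2 (h ω)
      _ = c := by simp
  have h2 : ∑ i, μ.real (A i) = (∑ i, μ (A i)).toReal :=
    (ENNReal.toReal_sum fun i _ => measure_ne_top _ _).symm
  rw [h2]
  exact ENNReal.toReal_le_of_le_ofReal (Nat.cast_nonneg _) (by simpa using h1)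

theorem matchProb_nonneg (P : R.Policy G.T) (t : Fin G.T) (i : Fin R.n) : 0 ≤ matchProb G P t i :=
  measureReal_nonneg

theorem sum_matchProb_le_one (P : R.Policy G.T) (t : Fin G.T) : ∑ i, matchProb G P t i ≤ 1 := by
  classical
  have := sum_measureReal_le_of_card_le (μ := law R G.T) (c := 1)
    (fun i => measurableSet_matched_eq P t (some i)) fun ω => by
      rw [Finset.card_le_one]
      intro i hi j hj
      simp only [Finset.mem_filter, Finset.mem_univ, true_and, Set.mem_ofPred_eq] at hi hj
      rw [hi] at hj
      exact Option.some_injective _ hj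
  simpa only [matchProb, Nat.cast_one] using this

theorem matched_eq_some_iff {P : R.Policy G.T} {u : Fin G.T → unitInterval}
    {d : Fin G.T → Fin R.n → ℝ≥0∞} {t : Fin G.T} {i : Fin R.n} :
    matched G P u d t = some i ↔
      P.choose t (fun s => matched G P u d (Fin.castLE t.isLt.le s))
        (fun s => if matchDuration (matched G P u d (Fin.castLE t.isLt.le s))
            (d (Fin.castLE t.isLt.le s)) ≤ elapsed G (Fin.castLE t.isLt.le s) t
          then matchDuration (matched G P u d (Fin.castLE t.isLt.le s))
            (d (Fin.castLE t.isLt.le s)) else ⊤)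
        (fun s => u (Fin.castLE t.isLt s)) = some i ∧ i ∈ (G.arr t).nbrs ∧
      (Finset.univ.filter fun s : Fin G.T => s < t ∧ matched G P u d s = some i ∧
        elapsed G s t < d s i).card < R.cap i := by
  rw [matched_eq, matchStep_eq_some_iff]
  refine and_congr_right fun _ => and_congr_right fun _ => ?_
  refine iff_of_eq (congrArg (· < R.cap i) ?_)
  refine Finset.card_bij (fun s _ => Fin.castLE t.isLt.le s) (fun s hs => ?_)
    (fun s _ s' _ h => Fin.castLE_injective _ h) fun s hs => ?_
  · simp only [Finset.mem_filter, Finset.mem_univ, true_and] at hs ⊢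
    exact ⟨s.isLt, hs⟩
  · simp only [Finset.mem_filter, Finset.mem_univ, true_and] at hs
    exact ⟨⟨s, hs.1⟩, by simpa using hs.2, rfl⟩

theorem matchProb_eq_zero (P : R.Policy G.T) {t : Fin G.T} {i : Fin R.n}
    (hi : i ∉ (G.arr t).nbrs) : matchProb G P t i = 0 := by
  have : {ω : (Fin G.T → unitInterval) × (Fin G.T → Fin R.n → ℝ≥0∞) |
      matched G P ω.1 ω.2 t = some i} = ∅ := by
    ext ω
    simp only [Set.mem_ofPred_eq, Set.mem_empty_iff_false, iff_false]
    exact fun h => hi (matched_eq_some_iff.1 h).2.1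
  rw [matchProb, this, measureReal_empty]

open Classical in
-- Consider the last of the counted matches. All others were already running when it was made, and
-- it required a free unit.
theorem card_occupied_le (P : R.Policy G.T) (u : Fin G.T → unitInterval)
    (d : Fin G.T → Fin R.n → ℝ≥0∞) (t : Fin G.T) (i : Fin R.n) :
    (Finset.univ.filter fun s : Fin G.T => matched G P u d s = some i ∧
      (s = t ∨ s < t ∧ elapsed G s t < d s i)).card ≤ R.cap i := by
  set F := Finset.univ.filter fun s : Fin G.T => matched G P u d s = some i ∧
      (s = t ∨ s < t ∧ elapsed G s t < d s i) with hF
  rcases F.eq_empty_or_nonempty with h | h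
  · simp [h]
  · have hm := F.max'_mem h
    set m := F.max' h with hmdef
    simp only [hF, Finset.mem_filter, Finset.mem_univ, true_and] at hm
    have hmt : m ≤ t := hm.2.elim (fun h => h.le) fun h => h.1.le
    have h1 := (matched_eq_some_iff.1 hm.1).2.2
    have h2 : F.erase m ⊆ Finset.univ.filter fun s : Fin G.T => s < m ∧
        matched G P u d s = some i ∧ elapsed G s m < d s i := by
      intro s hs
      have hsF := (Finset.mem_erase.1 hs).2
      have hsm : s < m := lt_of_le_of_ne (F.le_max' s hsF) (Finset.mem_erase.1 hs).1
      simp only [hF, Finset.mem_filter, Finset.mem_univ, true_and] at hsF ⊢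
      refine ⟨hsm, hsF.1, (elapsed_mono_right G s hmt).trans_lt ?_⟩
      rcases hsF.2 with h | h
      · exact absurd (hsm.trans_le hmt) (h ▸ lt_irrefl s)
      · exact h.2
    have h3 := Finset.card_le_card h2
    rw [Finset.card_erase_of_mem (F.max'_mem h)] at h3
    have : (Finset.univ.filter fun s : Fin G.T => s < m ∧
        matched G P u d s = some i ∧ elapsed G s m < d s i).card < R.cap i := by
      convert h1
    omega

/-- Independence of one coordinate from an event that ignores it: the two sides agree once this
coordinate alone is integrated out. -/
theorem pi_inter_eval_preimage {ι : Type*} [Fintype ι] [DecidableEq ι] {X : ι → Type*}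
    [∀ j, MeasurableSpace (X j)] (μ : ∀ j, Measure (X j)) [∀ j, IsProbabilityMeasure (μ j)] (j : ι)
    {A : Set (∀ j, X j)} (hA : MeasurableSet A) {B : Set (X j)} (hB : MeasurableSet B)
    (h : ∀ x y, Function.update x j y ∈ A ↔ x ∈ A) :
    Measure.pi μ (A ∩ Function.eval j ⁻¹' B) = Measure.pi μ A * μ j B := by
  have hE : MeasurableSet (A ∩ Function.eval j ⁻¹' B) := hA.inter (measurable_pi_apply j hB)
  have hf : Measurable ((A ∩ Function.eval j ⁻¹' B).indicator (1 : (∀ j, X j) → ℝ≥0∞)) :=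
    measurable_one.indicator hE
  have hg : Measurable fun x => A.indicator (1 : (∀ j, X j) → ℝ≥0∞) x * μ j B :=
    (measurable_one.indicator hA).mul_const _
  rw [← lintegral_indicator_one hE, ← lintegral_indicator_one hA,
    ← lintegral_mul_const _ (measurable_one.indicator hA)]
  refine lintegral_eq_of_lmarginal_eq {j} hf hg ?_
  rw [lmarginal_singleton, lmarginal_singleton]
  funext x
  have h1 : ∀ y, (A ∩ Function.eval j ⁻¹' B).indicator (1 : (∀ j, X j) → ℝ≥0∞)
      (Function.update x j y) =
      B.indicator (fun _ => A.indicator (1 : (∀ j, X j) → ℝ≥0∞) x) y := fun y => by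
    by_cases hx : x ∈ A <;> by_cases hy : y ∈ B <;> simp [hx, hy, h]
  have h2 : ∀ y, A.indicator (1 : (∀ j, X j) → ℝ≥0∞) (Function.update x j y) =
      A.indicator (1 : (∀ j, X j) → ℝ≥0∞) x := fun y => by
    by_cases hx : x ∈ A <;> simp [hx, h]
  simp only [h1, h2]
  rw [lintegral_indicator_const hB, lintegral_const, measure_univ, mul_one]

theorem usage_Ioi (i : Fin R.n) (x : ℝ) :
    (R.usage i : Measure ℝ≥0∞) (Set.Ioi (ENNReal.ofReal x)) = ENNReal.ofReal (1 - R.cdf i x) := by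
  rw [← Set.compl_Iic, prob_compl_eq_one_sub measurableSet_Iic,
    ENNReal.ofReal_sub _ (cdf_nonneg i x), ENNReal.ofReal_one, cdf, ENNReal.ofReal_coe_nnreal]
  simp

/-- The duration of a match is independent of whether the match is made. -/
theorem law_matched_inter_lt (P : R.Policy G.T) (s : Fin G.T) (i : Fin R.n) (x : ℝ) :
    (law R G.T).real {ω | matched G P ω.1 ω.2 s = some i ∧ ENNReal.ofReal x < ω.2 s i} =
      (1 - R.cdf i x) * matchProb G P s i := by
  have hB : MeasurableSet {e : Fin R.n → ℝ≥0∞ | ENNReal.ofReal x < e i} :=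
    measurableSet_lt measurable_const (measurable_pi_apply i)
  have hA := measurableSet_matched_eq P s (some i)
  have hAB : MeasurableSet {ω : (Fin G.T → unitInterval) × (Fin G.T → Fin R.n → ℝ≥0∞) |
      matched G P ω.1 ω.2 s = some i ∧ ENNReal.ofReal x < ω.2 s i} :=
    hA.inter (measurableSet_lt_duration _ _ _)
  have hB' : Measure.pi (fun i => (R.usage i : Measure ℝ≥0∞))
      {e : Fin R.n → ℝ≥0∞ | ENNReal.ofReal x < e i} = ENNReal.ofReal (1 - R.cdf i x) := by
    rw [← usage_Ioi]
    exact (measurePreserving_eval (fun i => (R.usage i : Measure ℝ≥0∞)) i).measure_preimage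
      measurableSet_Ioi.nullMeasurableSet
  have key : law R G.T {ω | matched G P ω.1 ω.2 s = some i ∧ ENNReal.ofReal x < ω.2 s i} =
      law R G.T {ω | matched G P ω.1 ω.2 s = some i} * ENNReal.ofReal (1 - R.cdf i x) := by
    unfold law
    rw [Measure.prod_apply hAB, Measure.prod_apply hA,
      ← lintegral_mul_const _ (measurable_measure_prodMk_left hA)]
    refine lintegral_congr fun u => ?_
    rw [← hB']
    exact pi_inter_eval_preimage
      (fun _ : Fin G.T => Measure.pi fun i => (R.usage i : Measure ℝ≥0∞)) s
      (measurable_prodMk_left hA) hB fun d e => by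
        simp only [Set.mem_preimage, Set.mem_ofPred_eq]
        rw [matched_congr P (fun _ _ => rfl) fun r hr => Function.update_of_ne hr.ne _ _]
  rw [measureReal_def, key, ENNReal.toReal_mul,
    ENNReal.toReal_ofReal (sub_nonneg.2 (cdf_le_one i x)), mul_comm]
  rfl

/-- In expectation, a policy never occupies more units than there are. -/
theorem sum_occupancy_mul_matchProb_le (P : R.Policy G.T) (t : Fin G.T) (i : Fin R.n) :
    ∑ s, occupancy G.arr i s t * matchProb G P s i ≤ R.cap i := by
  classical
  have hmeas : ∀ s, MeasurableSet {ω : (Fin G.T → unitInterval) × (Fin G.T → Fin R.n → ℝ≥0∞) |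
      matched G P ω.1 ω.2 s = some i ∧ (s = t ∨ s < t ∧ elapsed G s t < ω.2 s i)} := fun s => by
    refine (measurableSet_matched_eq P s _).inter ((MeasurableSet.const _).union
      ((MeasurableSet.const _).inter (measurableSet_lt_duration _ _ _)))
  refine le_trans (le_of_eq (Finset.sum_congr rfl fun s _ => ?_))
    (sum_measureReal_le_of_card_le (μ := law R G.T) hmeas fun ω => ?_)
  · unfold occupancy
    by_cases h : s < t
    · rw [if_pos h, ← law_matched_inter_lt]
      simp [h, h.ne, elapsed]
    · by_cases h' : s = t
      · simp [h', matchProb]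
      · simp [h, h']
  · refine le_trans (le_of_eq ?_) (card_occupied_le P ω.1 ω.2 t i)
    congr!

end

section

/-! ### The algorithm SAMPLE -/

theorem sampleIndex_eq_some_iff {n : ℕ} {w : Fin n → ℝ} {u : ℝ} {i : Fin n} :
    sampleIndex w u = some i ↔
      u < ∑ j ∈ Finset.Iic i, w j ∧ ∀ k < i, ∑ j ∈ Finset.Iic k, w j ≤ u := by
  classical
  unfold sampleIndex
  rw [List.find?_eq_some_iff_getElem]
  simp only [decide_eq_true_eq, List.getElem_finRange, List.length_finRange, Bool.not_eq_eq_eq_not,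
    Bool.not_true, decide_eq_false_iff_not, not_lt]
  refine and_congr_right fun _ => ⟨?_, fun h => ?_⟩
  · rintro ⟨k, hk, rfl, h⟩ j hj
    simpa using h j (by simpa [Fin.lt_def] using hj)
  · exact ⟨i, i.isLt, by simp, fun j hj => by simpa using h ⟨j, hj.trans i.isLt⟩ hj⟩

/-- Inverse transform sampling. -/
theorem volume_sampleIndex_eq_some {n : ℕ} {w : Fin n → ℝ} (hw : ∀ i, 0 ≤ w i)
    (hw1 : ∑ i, w i ≤ 1) (i : Fin n) :
    volume {u : unitInterval | sampleIndex w u = some i} = ENNReal.ofReal (w i) := by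
  have hsplit : ∑ j ∈ Finset.Iic i, w j = w i + ∑ j ∈ Finset.Iio i, w j := by
    rw [← Finset.Iio_insert i, Finset.sum_insert (by simp)]
  have ha0 : 0 ≤ ∑ j ∈ Finset.Iio i, w j := Finset.sum_nonneg fun j _ => hw j
  have hb0 : 0 ≤ ∑ j ∈ Finset.Iic i, w j := Finset.sum_nonneg fun j _ => hw j
  have hb1 : ∑ j ∈ Finset.Iic i, w j ≤ 1 :=
    (Finset.sum_le_sum_of_subset_of_nonneg (Finset.subset_univ _) fun j _ _ => hw j).trans hw1
  have ha1 : ∑ j ∈ Finset.Iio i, w j ≤ 1 := by linarith [hw i]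
  have : {u : unitInterval | sampleIndex w u = some i} =
      Set.Ico ⟨∑ j ∈ Finset.Iio i, w j, ha0, ha1⟩ ⟨∑ j ∈ Finset.Iic i, w j, hb0, hb1⟩ := by
    ext u
    simp only [Set.mem_ofPred_eq, Set.mem_Ico, sampleIndex_eq_some_iff]
    rw [← Subtype.coe_le_coe, ← Subtype.coe_lt_coe, and_comm]
    refine and_congr_left fun _ => ⟨fun h => ?_, fun h k hk => le_trans ?_ h⟩
    -- The lower end of the interval comes from the predecessor of `i`; the first index has none,
    -- and there it is `0`.
    · by_cases hi : (i : ℕ) = 0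
      · have : Finset.Iio i = ∅ := by
          refine Finset.eq_empty_of_forall_notMem fun j hj => ?_
          have := Fin.lt_def.1 (Finset.mem_Iio.1 hj)
          omega
        simp only [this, Finset.sum_empty]
        exact u.2.1
      · have hlt : (i : ℕ) - 1 < n := by omega
        have hk : (⟨i - 1, hlt⟩ : Fin n) < i := by
          rw [Fin.lt_def]
          simp only
          omega
        have heq : Finset.Iio i = Finset.Iic ⟨i - 1, hlt⟩ := by
          ext j
          rw [Finset.mem_Iio, Finset.mem_Iic, Fin.lt_def, Fin.le_def]
          simp only
          omega
        simp only [heq]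
        exact h ⟨i - 1, hlt⟩ hk
    · refine Finset.sum_le_sum_of_subset_of_nonneg (fun j hj => ?_) fun j _ _ => hw j
      exact Finset.mem_Iio.2 ((Finset.mem_Iic.1 hj).trans_lt hk)
  rw [this, unitInterval.volume_Ico]
  congr 1
  simp only [hsplit]
  ring

variable {R : Resources} {G : R.ArrivalSeq}

theorem slack_nonneg (i : Fin R.n) : 0 ≤ R.slack i := Real.sqrt_nonneg _

/-- The probability with which SAMPLE chooses resource `i` at arrival `t`. -/
def sampleProb (tb : TieBreak R.Item) (G : R.ArrivalSeq) (t : Fin G.T) (i : Fin R.n) : ℝ :=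
  guideMatch tb G.arr t i / (1 + R.slack i)

theorem sampleProb_nonneg (tb : TieBreak R.Item) (t : Fin G.T) (i : Fin R.n) :
    0 ≤ sampleProb tb G t i :=
  div_nonneg (guideMatch_nonneg tb G.mono t i) (by linarith [slack_nonneg i])

theorem sum_sampleProb_le_one (tb : TieBreak R.Item) (t : Fin G.T) :
    ∑ i, sampleProb tb G t i ≤ 1 := by
  refine le_trans (Finset.sum_le_sum fun i _ => ?_) (sum_guideMatch_le_one tb G.mono t)
  exact div_le_self (guideMatch_nonneg tb G.mono t i) (by linarith [slack_nonneg i])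

/-- The set of seeds for which SAMPLE chooses resource `i` at arrival `t`. -/
def sampleSet (tb : TieBreak R.Item) (G : R.ArrivalSeq) (t : Fin G.T) (i : Fin R.n) :
    Set unitInterval :=
  {u | sampleIndex (sampleProb tb G t) u = some i}

theorem measurableSet_sampleSet (tb : TieBreak R.Item) (t : Fin G.T) (i : Fin R.n) :
    MeasurableSet (sampleSet tb G t i) :=
  measurable_subtype_coe (measurableSet_sampleIndex _ i)

theorem volume_sampleSet (tb : TieBreak R.Item) (t : Fin G.T) (i : Fin R.n) :
    volume.real (sampleSet tb G t i) = sampleProb tb G t i := by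
  unfold sampleSet
  rw [measureReal_def, volume_sampleIndex_eq_some (sampleProb_nonneg tb t)
    (sum_sampleProb_le_one tb t), ENNReal.toReal_ofReal (sampleProb_nonneg tb t i)]

theorem sample_choose_eq_some_iff (tb : TieBreak R.Item) (t : Fin G.T)
    (past : Fin t → Option (Fin R.n)) (obs : Fin t → ℝ≥0∞) (u : Fin G.T → unitInterval)
    (i : Fin R.n) :
    ((sample R tb).toPolicy G).choose t past obs (fun s => u (Fin.castLE t.isLt s)) = some i ↔
      u t ∈ sampleSet tb G t i := by
  change sampleIndex (fun i => guideMatch tb (initialArrivals G.arr t) (Fin.last t) i /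
    (1 + R.slack i)) (u (Fin.castLE t.isLt (Fin.last t))) = some i ↔
      sampleIndex (sampleProb tb G t) (u t) = some i
  simp only [guideMatch_initialArrivals]
  rfl

open Classical in
-- Every match to `i` stems from a choice of `i`. Counting choices instead of matches only
-- overestimates the units in use, and choices at different arrivals are independent.
theorem matched_sample_eq_some (tb : TieBreak R.Item) {t : Fin G.T} {i : Fin R.n}
    {u : Fin G.T → unitInterval} {d : Fin G.T → Fin R.n → ℝ≥0∞} (hi : i ∈ (G.arr t).nbrs)
    (hu : u t ∈ sampleSet tb G t i)
    (hc : (Finset.univ.filter fun s : Fin G.T => s < t ∧ u s ∈ sampleSet tb G s i ∧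
      elapsed G s t < d s i).card < R.cap i) :
    matched G ((sample R tb).toPolicy G) u d t = some i := by
  rw [matched_eq_some_iff]
  refine ⟨(sample_choose_eq_some_iff tb t _ _ u i).2 hu, hi, lt_of_le_of_lt ?_ hc⟩
  refine Finset.card_le_card fun s hs => ?_
  simp only [Finset.mem_filter, Finset.mem_univ, true_and] at hs ⊢
  exact ⟨hs.1, (sample_choose_eq_some_iff tb s _ _ u i).1 (matched_eq_some_iff.1 hs.2.1).1, hs.2.2⟩

/-! ### The Chernoff bound for blocked units -/

/-- The joint law of the seed and the durations at a single arrival. -/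
def stepLaw (R : Resources) : Measure (unitInterval × (Fin R.n → ℝ≥0∞)) :=
  volume.prod (Measure.pi fun i => (R.usage i : Measure ℝ≥0∞))

instance isProbabilityMeasure_stepLaw (R : Resources) : IsProbabilityMeasure (stepLaw R) := by
  unfold stepLaw
  infer_instance

theorem measurePreserving_law (R : Resources) (T : ℕ) :
    MeasurePreserving
      (MeasurableEquiv.arrowProdEquivProdArrow unitInterval (Fin R.n → ℝ≥0∞) (Fin T))
      (Measure.pi fun _ => stepLaw R) (law R T) :=
  measurePreserving_arrowProdEquivProdArrow _ _ _ _ _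

theorem integral_prod_law {T : ℕ} (g : Fin T → unitInterval × (Fin R.n → ℝ≥0∞) → ℝ) :
    ∫ ω, ∏ s, g s (ω.1 s, ω.2 s) ∂(law R T) = ∏ s, ∫ q, g s q ∂(stepLaw R) := by
  rw [← (measurePreserving_law R T).integral_comp']
  exact integral_fintype_prod_eq_prod g

theorem integrable_prod_law {T : ℕ} {g : Fin T → unitInterval × (Fin R.n → ℝ≥0∞) → ℝ}
    (hg : ∀ s, Integrable (g s) (stepLaw R)) :
    Integrable (fun ω => ∏ s, g s (ω.1 s, ω.2 s)) (law R T) := by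
  rw [← (measurePreserving_law R T).integrable_comp_emb (MeasurableEquiv.measurableEmbedding _)]
  exact Integrable.fintype_prod hg

/-- The event that SAMPLE chooses `i` at `s`, and that the duration exceeds the time until `t`. -/
def blockSet (tb : TieBreak R.Item) (G : R.ArrivalSeq) (s t : Fin G.T) (i : Fin R.n) :
    Set (unitInterval × (Fin R.n → ℝ≥0∞)) :=
  sampleSet tb G s i ×ˢ {e | elapsed G s t < e i}

theorem measurableSet_blockSet (tb : TieBreak R.Item) (s t : Fin G.T) (i : Fin R.n) :
    MeasurableSet (blockSet tb G s t i) :=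
  (measurableSet_sampleSet tb s i).prod (measurableSet_lt measurable_const (measurable_pi_apply i))

theorem stepLaw_blockSet (tb : TieBreak R.Item) {s t : Fin G.T} (h : s < t) (i : Fin R.n) :
    (stepLaw R).real (blockSet tb G s t i) = occupancy G.arr i s t * sampleProb tb G s i := by
  have hB : Measure.pi (fun i => (R.usage i : Measure ℝ≥0∞))
      {e : Fin R.n → ℝ≥0∞ | elapsed G s t < e i} =
        ENNReal.ofReal (1 - R.cdf i ((G.arr t).time - (G.arr s).time)) := by
    rw [← usage_Ioi]
    exact (measurePreserving_eval (fun i => (R.usage i : Measure ℝ≥0∞)) i).measure_preimage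
      measurableSet_Ioi.nullMeasurableSet
  rw [stepLaw, blockSet, measureReal_prod_prod, volume_sampleSet, measureReal_def, hB,
    ENNReal.toReal_ofReal (sub_nonneg.2 (cdf_le_one _ _)), occupancy_of_lt h, mul_comm]

theorem stepLaw_sampleSet (tb : TieBreak R.Item) (t : Fin G.T) (i : Fin R.n) :
    (stepLaw R).real (sampleSet tb G t i ×ˢ Set.univ) = sampleProb tb G t i := by
  rw [stepLaw, measureReal_prod_prod, volume_sampleSet, probReal_univ, mul_one]

open Classical in
/-- The factor of arrival `s` in the exponential moment of the number of units of `i` that are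
occupied at `t`, on the event that `i` is chosen at `t`. -/
def momentFactor (tb : TieBreak R.Item) (G : R.ArrivalSeq) (t : Fin G.T) (i : Fin R.n)
    (s : Fin G.T) (q : unitInterval × (Fin R.n → ℝ≥0∞)) : ℝ :=
  if s < t then 1 + (blockSet tb G s t i).indicator (fun _ => R.slack i) q
  else if s = t then (sampleSet tb G t i ×ˢ Set.univ).indicator 1 q else 1

theorem integrable_momentFactor (tb : TieBreak R.Item) (t : Fin G.T) (i : Fin R.n) (s : Fin G.T) :
    Integrable (momentFactor tb G t i s) (stepLaw R) := by
  unfold momentFactor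
  split_ifs
  · exact (integrable_const _).add ((integrable_const _).indicator (measurableSet_blockSet tb s t i))
  · exact (integrable_const _).indicator ((measurableSet_sampleSet tb t i).prod MeasurableSet.univ)
  · exact integrable_const _

theorem integral_momentFactor_self (tb : TieBreak R.Item) (t : Fin G.T) (i : Fin R.n) :
    ∫ q, momentFactor tb G t i t q ∂(stepLaw R) = sampleProb tb G t i := by
  simp only [momentFactor, lt_irrefl, if_false, if_true]
  rw [integral_indicator_one ((measurableSet_sampleSet tb t i).prod MeasurableSet.univ),
    stepLaw_sampleSet]

theorem integral_momentFactor_le (tb : TieBreak R.Item) {s t : Fin G.T} (h : s ≠ t) (i : Fin R.n) :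
    ∫ q, momentFactor tb G t i s q ∂(stepLaw R) ≤
      Real.exp (R.slack i * (occupancy G.arr i s t * sampleProb tb G s i)) := by
  by_cases hst : s < t
  · simp only [momentFactor, hst, if_true]
    rw [integral_add (integrable_const _)
      ((integrable_const _).indicator (measurableSet_blockSet tb s t i)),
      integral_indicator_const _ (measurableSet_blockSet tb s t i), stepLaw_blockSet tb hst]
    simp only [integral_const, probReal_univ, smul_eq_mul, mul_one]
    rw [mul_comm _ (R.slack i), add_comm]
    exact Real.add_one_le_exp _
  · simp only [momentFactor, hst, h, if_false]
    simp only [integral_const, probReal_univ, smul_eq_mul, mul_one]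
    exact Real.one_le_exp (mul_nonneg (slack_nonneg i)
      (mul_nonneg ((isOccupancyKernel G.mono i).nonneg _ _) (sampleProb_nonneg tb s i)))

/-- The expectation factorizes over arrivals, and `1 + x ≤ exp x` turns the product into the
exponential of `δ_i` times the expected occupancy, at most `c_i / (1 + δ_i)` by feasibility of the
guide. -/
theorem integral_prod_momentFactor_le (tb : TieBreak R.Item) (t : Fin G.T) (i : Fin R.n) :
    ∫ ω, ∏ s, momentFactor tb G t i s (ω.1 s, ω.2 s) ∂(law R G.T) ≤
      sampleProb tb G t i * Real.exp (R.slack i * (R.cap i / (1 + R.slack i))) := by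
  classical
  have hδ := slack_nonneg i
  have hnn : ∀ s, 0 ≤ occupancy G.arr i s t * sampleProb tb G s i := fun s =>
    mul_nonneg ((isOccupancyKernel G.mono i).nonneg _ _) (sampleProb_nonneg tb s i)
  rw [integral_prod_law, ← Finset.mul_prod_erase _ _ (Finset.mem_univ t),
    integral_momentFactor_self]
  refine mul_le_mul_of_nonneg_left ?_ (sampleProb_nonneg tb t i)
  calc ∏ s ∈ Finset.univ.erase t, ∫ q, momentFactor tb G t i s q ∂(stepLaw R)
      ≤ ∏ s ∈ Finset.univ.erase t,
          Real.exp (R.slack i * (occupancy G.arr i s t * sampleProb tb G s i)) := by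
        refine Finset.prod_le_prod (fun s hs => integral_nonneg fun q => ?_) fun s hs =>
          integral_momentFactor_le tb (Finset.ne_of_mem_erase hs) i
        have h1 : 0 ≤ (blockSet tb G s t i).indicator (fun _ => R.slack i) q :=
          Set.indicator_nonneg (fun _ _ => hδ) _
        simp only [momentFactor, Finset.ne_of_mem_erase hs, if_false, Pi.zero_apply]
        split_ifs <;> linarith
    _ = Real.exp (R.slack i *
          ∑ s ∈ Finset.univ.erase t, occupancy G.arr i s t * sampleProb tb G s i) := by
        rw [← Real.exp_sum, Finset.mul_sum]
    _ ≤ _ := by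
        refine Real.exp_le_exp.2 (mul_le_mul_of_nonneg_left ?_ hδ)
        calc ∑ s ∈ Finset.univ.erase t, occupancy G.arr i s t * sampleProb tb G s i
            ≤ ∑ s, occupancy G.arr i s t * sampleProb tb G s i :=
              Finset.sum_le_sum_of_subset_of_nonneg (Finset.subset_univ _) fun s _ _ => hnn s
          _ = (∑ s, occupancy G.arr i s t * guideMatch tb G.arr s i) / (1 + R.slack i) := by
              rw [Finset.sum_div]
              exact Finset.sum_congr rfl fun s _ => by rw [sampleProb, mul_div_assoc]
          _ ≤ _ := div_le_div_of_nonneg_right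
              (sum_occupancy_mul_guideMatch_le tb G.mono t i) (by linarith)

open Classical in
theorem pow_le_prod_momentFactor (tb : TieBreak R.Item) {t : Fin G.T} {i : Fin R.n}
    {u : Fin G.T → unitInterval} {d : Fin G.T → Fin R.n → ℝ≥0∞} (hu : u t ∈ sampleSet tb G t i)
    (hc : R.cap i ≤ (Finset.univ.filter fun s : Fin G.T => s < t ∧ u s ∈ sampleSet tb G s i ∧
      elapsed G s t < d s i).card) :
    (1 + R.slack i) ^ R.cap i ≤ ∏ s, momentFactor tb G t i s (u s, d s) := by
  refine (pow_le_pow_right₀ (by linarith [slack_nonneg i]) hc).trans (le_of_eq ?_)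
  rw [← Finset.prod_const, Finset.prod_filter]
  refine Finset.prod_congr rfl fun s _ => ?_
  unfold momentFactor
  by_cases hst : s < t
  · have hmem : (u s, d s) ∈ blockSet tb G s t i ↔
        u s ∈ sampleSet tb G s i ∧ elapsed G s t < d s i := Iff.rfl
    by_cases h : u s ∈ sampleSet tb G s i ∧ elapsed G s t < d s i
    · rw [if_pos ⟨hst, h⟩, if_pos hst, Set.indicator_of_mem (hmem.2 h)]
    · rw [if_neg fun h' => h h'.2, if_pos hst, Set.indicator_of_notMem fun h' => h (hmem.1 h'),
        add_zero]
  · rw [if_neg fun h => hst h.1, if_neg hst]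
    by_cases h : s = t
    · subst h
      rw [if_pos rfl, Set.indicator_of_mem (Set.mk_mem_prod hu (Set.mem_univ _)), Pi.one_apply]
    · rw [if_neg h]

/-- SAMPLE matches `t` to `i` if it chooses `i`, up to the probability that too many units are
occupied, which is controlled by an exponential moment. -/
theorem le_matchProb_sample (tb : TieBreak R.Item) (t : Fin G.T) (i : Fin R.n) :
    sampleProb tb G t i * (1 - Real.exp (R.slack i * (R.cap i / (1 + R.slack i))) /
      (1 + R.slack i) ^ R.cap i) ≤ matchProb G ((sample R tb).toPolicy G) t i := by
  classical
  by_cases hi : i ∈ (G.arr t).nbrs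
  · have hδ := slack_nonneg i
    have hpow : 0 < (1 + R.slack i) ^ R.cap i := pow_pos (by linarith) _
    set f : (Fin G.T → unitInterval) × (Fin G.T → Fin R.n → ℝ≥0∞) → ℝ :=
      fun ω => ∏ s, momentFactor tb G t i s (ω.1 s, ω.2 s) with hf
    have hf0 : 0 ≤ f := fun ω => Finset.prod_nonneg fun s _ => by
      have h1 : 0 ≤ (blockSet tb G s t i).indicator (fun _ => R.slack i) (ω.1 s, ω.2 s) :=
        Set.indicator_nonneg (fun _ _ => hδ) _
      have h2 : 0 ≤ (sampleSet tb G t i ×ˢ Set.univ).indicator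
          (1 : unitInterval × (Fin R.n → ℝ≥0∞) → ℝ) (ω.1 s, ω.2 s) :=
        Set.indicator_nonneg (fun _ _ => zero_le_one) _
      unfold momentFactor
      split_ifs <;> linarith
    -- Markov's inequality. The factor at `t` is the indicator of choosing `i`, so the bound on the
    -- bad event carries the factor `sampleProb` without any conditioning.
    have hmarkov := mul_meas_ge_le_integral_of_nonneg (Filter.Eventually.of_forall hf0)
      (integrable_prod_law fun s => integrable_momentFactor tb t i s)
      ((1 + R.slack i) ^ R.cap i)
    have hbad := hmarkov.trans (integral_prod_momentFactor_le tb t i)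
    have hE : (law R G.T).real {ω | ω.1 t ∈ sampleSet tb G t i} = sampleProb tb G t i := by
      rw [← volume_sampleSet]
      have h1 : MeasurePreserving (fun ω : (Fin G.T → unitInterval) ×
          (Fin G.T → Fin R.n → ℝ≥0∞) => ω.1 t) (law R G.T) volume :=
        (measurePreserving_eval (fun _ : Fin G.T => (volume : Measure unitInterval)) t).comp
          measurePreserving_fst
      exact h1.measureReal_preimage (measurableSet_sampleSet tb t i).nullMeasurableSet
    have hsub : {ω : (Fin G.T → unitInterval) × (Fin G.T → Fin R.n → ℝ≥0∞) |
        ω.1 t ∈ sampleSet tb G t i} ⊆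
        {ω | matched G ((sample R tb).toPolicy G) ω.1 ω.2 t = some i} ∪
          {ω | (1 + R.slack i) ^ R.cap i ≤ f ω} := by
      intro ω hω
      by_cases hc : (Finset.univ.filter fun s : Fin G.T => s < t ∧ ω.1 s ∈ sampleSet tb G s i ∧
          elapsed G s t < ω.2 s i).card < R.cap i
      · exact Or.inl (matched_sample_eq_some tb hi hω hc)
      · exact Or.inr (pow_le_prod_momentFactor tb hω (not_lt.1 hc))
    have hle := (measureReal_mono hsub).trans (measureReal_union_le (μ := law R G.T) _ _)
    rw [hE] at hle
    have hbad' : (law R G.T).real {ω | (1 + R.slack i) ^ R.cap i ≤ f ω} ≤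
        sampleProb tb G t i * Real.exp (R.slack i * (R.cap i / (1 + R.slack i))) /
          (1 + R.slack i) ^ R.cap i := by
      rw [le_div_iff₀ hpow, mul_comm]
      exact hbad
    rw [mul_sub, mul_one, ← mul_div_assoc]
    unfold matchProb
    linarith
  · rw [matchProb_eq_zero _ hi, sampleProb, guideMatch_eq_zero tb G.mono hi]
    simp

end

section

/-! ### The competitive ratio of SAMPLE -/

/-- Since `log x / x` decreases from `e` on, the errors of all resources are controlled by the
minimal capacity. -/
theorem log_div_le_of_le {m c : ℕ} (hm : 1024 ≤ m) (hc : m ≤ c) :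
    Real.log c / c ≤ Real.log m / m := by
  have h3 : Real.exp 1 ≤ 1024 := by linarith [Real.exp_one_lt_d9]
  have h1 : Real.exp 1 ≤ (m : ℝ) := h3.trans (by exact_mod_cast hm)
  have h2 : (m : ℝ) ≤ c := by exact_mod_cast hc
  exact Real.log_div_self_antitoneOn h1 (h1.trans h2) h2

theorem log_div_le {c : ℕ} (hc : 1024 ≤ c) : Real.log c / c ≤ 1 / 100 := by
  refine (log_div_le_of_le le_rfl hc).trans ?_
  have h : Real.log ((1024 : ℕ) : ℝ) = 10 * Real.log 2 := by
    rw [show ((1024 : ℕ) : ℝ) = 2 ^ 10 by norm_num, Real.log_pow]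
    norm_num
  rw [h, div_le_div_iff₀ (by norm_num) (by norm_num)]
  have := Real.log_two_lt_d9
  push_cast
  linarith

theorem one_le_log {c : ℕ} (hc : 1024 ≤ c) : 1 ≤ Real.log c := by
  have h1 : (1024 : ℝ) ≤ c := by exact_mod_cast hc
  rw [Real.le_log_iff_exp_le (by linarith)]
  linarith [Real.exp_one_lt_d9]

/-- With slack `δ = √(2 log c / c)`, the exponential moment bound on the failure probability is at
most `1 / √c`. -/
theorem exp_div_pow_le {c : ℕ} (hc : 1024 ≤ c) {δ : ℝ} (hδ : δ = √(2 * Real.log c / c)) :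
    Real.exp (δ * (c / (1 + δ))) / (1 + δ) ^ c ≤ √(Real.log c / c) := by
  have hc0 : (0 : ℝ) < c := by exact_mod_cast (by omega : 0 < c)
  have hlog := one_le_log hc
  have hδ0 : 0 ≤ δ := hδ ▸ Real.sqrt_nonneg _
  have hsq : δ ^ 2 = 2 * Real.log c / c := by
    rw [hδ, Real.sq_sqrt (by positivity)]
  have hsmall : δ ≤ 1 / 2 := by
    have h1 : δ ^ 2 ≤ (1 / 2) ^ 2 := by
      rw [hsq, mul_div_assoc]
      linarith [log_div_le hc]
    exact le_of_sq_le_sq h1 (by norm_num)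
  have hle : Real.exp (δ * (c / (1 + δ))) / (1 + δ) ^ c ≤ Real.exp (-(Real.log c / 2)) := by
    have hpow : (1 + δ) ^ c = Real.exp (c * Real.log (1 + δ)) := by
      rw [mul_comm, Real.exp_mul, Real.exp_log (by linarith), Real.rpow_natCast]
    rw [hpow, ← Real.exp_sub]
    refine Real.exp_le_exp.2 ?_
    -- The bound `log (1 + δ) ≥ 2δ / (δ + 2)` is sharp to second order and leaves the exponent `-c
    -- δ² / ((1 + δ)(δ + 2))`. Here `c δ² = 2 log c`, and the denominator is at most `4` as `δ ≤
    -- 1/2`.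
    have h1 := Real.le_log_one_add_of_nonneg hδ0
    have h2 : δ * (c / (1 + δ)) - c * (2 * δ / (δ + 2)) =
        -(c * δ ^ 2 / ((1 + δ) * (δ + 2))) := by
      field_simp
      ring
    have h3 : c * δ ^ 2 = 2 * Real.log c := by
      rw [hsq]
      field_simp
    have h4 : Real.log c / 2 ≤ c * δ ^ 2 / ((1 + δ) * (δ + 2)) := by
      rw [h3, div_le_div_iff₀ (by norm_num) (by positivity)]
      have : (1 + δ) * (δ + 2) ≤ 4 := by nlinarith
      nlinarith
    have h5 := mul_le_mul_of_nonneg_left h1 hc0.le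
    linarith
  have heq : Real.exp (-(Real.log c / 2)) = √(1 / c) := by
    rw [Real.sqrt_eq_rpow, Real.rpow_def_of_pos (by positivity), Real.log_div one_ne_zero hc0.ne',
      Real.log_one]
    ring_nf
  rw [heq] at hle
  exact hle.trans (Real.sqrt_le_sqrt (div_le_div_of_nonneg_right hlog hc0.le))

theorem sqrt_two_mul_le (x : ℝ) : √(2 * x) ≤ 2 * √x := by
  rw [Real.sqrt_mul zero_le_two]
  refine mul_le_mul_of_nonneg_right ?_ (Real.sqrt_nonneg x)
  rw [Real.sqrt_le_left zero_le_two]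
  norm_num

variable {R : Resources}

/-- Scaling down by `1 + δ_i` costs at most `2 * D`, blocked units cost at most `D`. -/
theorem matchProb_sample_ge (tb : TieBreak R.Item) (G : R.ArrivalSeq) {m : ℕ} (hm : 1024 ≤ m)
    {i : Fin R.n} (hi : m ≤ R.cap i) (t : Fin G.T) :
    (1 - 3 * √(Real.log m / m)) * guideMatch tb G.arr t i ≤
      matchProb G ((sample R tb).toPolicy G) t i := by
  have hc := hm.trans hi
  have hD : √(Real.log (R.cap i) / R.cap i) ≤ √(Real.log m / m) :=
    Real.sqrt_le_sqrt (log_div_le_of_le hm hi)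
  set D := √(Real.log (R.cap i) / R.cap i)
  have hD0 : 0 ≤ D := Real.sqrt_nonneg _
  have hfail := exp_div_pow_le hc (δ := R.slack i) rfl
  have hδ : R.slack i ≤ 2 * D := by
    unfold slack
    rw [mul_div_assoc]
    exact sqrt_two_mul_le _
  have hδ0 := slack_nonneg i
  have hx := guideMatch_nonneg tb G.mono t i
  refine le_trans ?_ (le_matchProb_sample tb t i)
  have h1 : sampleProb tb G t i * (1 - D) ≤ sampleProb tb G t i *
      (1 - Real.exp (R.slack i * (R.cap i / (1 + R.slack i))) / (1 + R.slack i) ^ R.cap i) :=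
    mul_le_mul_of_nonneg_left (by linarith) (sampleProb_nonneg tb t i)
  refine le_trans ?_ h1
  have hD1 : D ≤ 1 := by
    rw [Real.sqrt_le_one]
    linarith [log_div_le hc]
  have h2 : (1 - 2 * D) * guideMatch tb G.arr t i ≤ sampleProb tb G t i := by
    unfold sampleProb
    rw [le_div_iff₀ (by linarith)]
    have : (1 - 2 * D) * (1 + R.slack i) ≤ 1 := by nlinarith
    nlinarith
  have h3 := mul_le_mul_of_nonneg_right h2 (by linarith : 0 ≤ 1 - D)
  refine le_trans ?_ h3
  have h4 : (1 - 3 * √(Real.log m / m)) ≤ (1 - 2 * D) * (1 - D) := by nlinarith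
  nlinarith

theorem cmin_le (i : Fin R.n) : R.cmin ≤ R.cap i := ciInf_le (OrderBot.bddBelow _) i

/-- Of the loss `4 * D`, sampling accounts for `3 * D`, and the discretization loss `1/m ≤ D` of the
guide for the rest. -/
theorem sample_competitive (tb : TieBreak R.Item) (G : R.ArrivalSeq) (hm : 1024 ≤ R.cmin)
    (P : R.Policy G.T) :
    (1 - 1 / Real.exp 1 - 4 * √(Real.log R.cmin / R.cmin)) *
        ∑ t, ∑ i, R.reward i * matchProb G P t i ≤
      ∑ t, ∑ i, R.reward i * matchProb G ((sample R tb).toPolicy G) t i := by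
  set m := R.cmin with hmdef
  set D := √(Real.log m / m)
  have hm0 : (0 : ℝ) < m := by exact_mod_cast (by omega : 0 < m)
  have hD0 : 0 ≤ D := Real.sqrt_nonneg _
  have hD1 : D ≤ 1 / 10 := by
    refine Real.sqrt_le_iff.2 ⟨by norm_num, ?_⟩
    linarith [log_div_le hm]
  have hmD : 1 / (m : ℝ) ≤ D := by
    refine Real.le_sqrt_of_sq_le ?_
    have h1 : (1 / (m : ℝ)) ^ 2 ≤ 1 / m := by
      have : 1 / (m : ℝ) ≤ 1 := by
        rw [div_le_one hm0]
        exact_mod_cast (by omega : 1 ≤ m)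
      have h0 : 0 ≤ 1 / (m : ℝ) := by positivity
      nlinarith
    exact h1.trans (div_le_div_of_nonneg_right (one_le_log hm) hm0.le)
  have hguide := guide_competitive tb G.mono (by omega : 0 < m) cmin_le
    (matchProb_nonneg P) (sum_matchProb_le_one P) (fun t i => matchProb_eq_zero P)
    (sum_occupancy_mul_matchProb_le P)
  set V := ∑ t, ∑ i, (R.reward i : ℝ) * matchProb G P t i with hV
  set X := ∑ t, ∑ i, (R.reward i : ℝ) * guideMatch tb G.arr t i with hX
  have hV0 : 0 ≤ V := Finset.sum_nonneg fun t _ => Finset.sum_nonneg fun i _ =>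
    mul_nonneg (NNReal.coe_nonneg _) (matchProb_nonneg P t i)
  have hX0 : 0 ≤ X := Finset.sum_nonneg fun t _ => Finset.sum_nonneg fun i _ =>
    mul_nonneg (NNReal.coe_nonneg _) (guideMatch_nonneg tb G.mono t i)
  have hsample : (1 - 3 * D) * X ≤
      ∑ t, ∑ i, R.reward i * matchProb G ((sample R tb).toPolicy G) t i := by
    rw [hX, Finset.mul_sum]
    refine Finset.sum_le_sum fun t _ => ?_
    rw [Finset.mul_sum]
    refine Finset.sum_le_sum fun i _ => ?_
    rw [mul_left_comm]
    exact mul_le_mul_of_nonneg_left (matchProb_sample_ge tb G hm (cmin_le i) t)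
      (NNReal.coe_nonneg _)
  refine le_trans ?_ hsample
  have he : Real.exp (-1) = 1 / Real.exp 1 := by rw [Real.exp_neg, one_div]
  have he1 : 1 / Real.exp 1 ≤ 1 := by
    rw [← he]
    exact Real.exp_le_one_iff.2 (by norm_num)
  have he0 : 0 < 1 / Real.exp 1 := by positivity
  rw [he] at hguide
  set e := 1 / Real.exp 1
  have h1 : (1 - e) * V ≤ (1 + D) * X := hguide.trans (mul_le_mul_of_nonneg_right (by linarith) hX0)
  have h2 : (1 - D) * ((1 - e) * V) ≤ X := by
    have := mul_le_mul_of_nonneg_left h1 (by linarith : 0 ≤ 1 - D)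
    have h0 := mul_nonneg (mul_nonneg hD0 hD0) hX0
    linarith
  have h3 := mul_le_mul_of_nonneg_left h2 (by linarith : 0 ≤ 1 - 3 * D)
  refine le_trans ?_ h3
  have h4 : 1 - e - 4 * D ≤ (1 - 3 * D) * ((1 - D) * (1 - e)) := by
    have h5 := mul_nonneg (sub_nonneg.2 he1) (sq_nonneg D)
    have h6 := mul_nonneg hD0 he0.le
    linarith
  calc (1 - e - 4 * D) * V ≤ (1 - 3 * D) * ((1 - D) * (1 - e)) * V :=
        mul_le_mul_of_nonneg_right h4 hV0
    _ = _ := by ring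

/-- The loss `δ` in the guarantee of SAMPLE. -/
def sampleLoss (c : ℕ) : ℝ := if 1024 ≤ c then 4 * √(Real.log c / c) else 1

theorem sampleLoss_eventuallyEq :
    sampleLoss =ᶠ[atTop] fun c : ℕ => 4 * √(Real.log c / c) := by
  filter_upwards [eventually_ge_atTop 1024] with c hc
  exact if_pos hc

theorem sampleLoss_isBigO : sampleLoss =O[atTop] fun c : ℕ => √(Real.log c / c) :=
  sampleLoss_eventuallyEq.trans_isBigO ((isBigO_refl _ _).const_mul_left 4)

theorem tendsto_sampleLoss : Tendsto sampleLoss atTop (𝓝 0) := by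
  refine Tendsto.congr' sampleLoss_eventuallyEq.symm ?_
  have h1 : Tendsto (fun x : ℝ => Real.log x / x) atTop (𝓝 0) :=
    Real.isLittleO_log_id_atTop.tendsto_div_nhds_zero
  have h2 := (Real.continuous_sqrt.tendsto 0).comp (h1.comp tendsto_natCast_atTop_atTop)
  simpa using h2.const_mul 4

theorem ofReal_mul_opt_le_sample (tb : TieBreak R.Item) (G : R.ArrivalSeq) :
    ENNReal.ofReal (1 - 1 / Real.exp 1 - sampleLoss R.cmin) * opt G ≤ (sample R tb).value G := by
  by_cases hm : 1024 ≤ R.cmin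
  · unfold opt
    rw [ENNReal.mul_iSup]
    refine iSup_le fun P => ?_
    rw [OnlineAlgorithm.value, value_eq_ofReal, value_eq_ofReal, ← ENNReal.ofReal_mul' ?_]
    · refine ENNReal.ofReal_le_ofReal ?_
      rw [sampleLoss, if_pos hm]
      exact sample_competitive tb G hm P
    · exact Finset.sum_nonneg fun t _ => Finset.sum_nonneg fun i _ =>
        mul_nonneg (NNReal.coe_nonneg _) (matchProb_nonneg P t i)
  -- With loss `1` the factor is negative and truncates to `0`. This includes the case of no
  -- resources, where the infimum `cmin` is `0`.
  · rw [sampleLoss, if_neg hm, ENNReal.ofReal_of_nonpos, zero_mul]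
    · exact zero_le
    · have : 0 < 1 / Real.exp 1 := by positivity
      linarith

end

section

/-! ### Averaging over random orders of the resources -/

/-- The term of `j` occurs `M - j` times, and `(M - j) / (n - j) = 1 - (n - M) / (n - j)`. -/
theorem sum_sum_inv_eq {n M : ℕ} (hM : M ≤ n) :
    ∑ m ∈ Finset.range M, ∑ j ∈ Finset.range (m + 1), (1 / ((n : ℝ) - j)) =
      M - ((n : ℝ) - M) * ∑ j ∈ Finset.range M, (1 / ((n : ℝ) - j)) := by
  induction M with
  | zero => simp
  | succ M ih =>
    have hne : (n : ℝ) - M ≠ 0 := by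
      have : (M : ℝ) < n := by exact_mod_cast hM
      linarith
    rw [Finset.sum_range_succ, ih (by omega), Finset.sum_range_succ]
    push_cast
    field_simp
    ring

theorem log_sub_log_le_sum_inv {n M : ℕ} (hM : M ≤ n) :
    Real.log (n + 1) - Real.log (n - M + 1) ≤ ∑ j ∈ Finset.range M, (1 / ((n : ℝ) - j)) := by
  induction M with
  | zero => simp
  | succ M ih =>
    rw [Finset.sum_range_succ]
    have hpos : 0 < (n : ℝ) - M := by
      have : (M : ℝ) < n := by exact_mod_cast hM
      linarith
    have h1 : Real.log (n - M + 1) - Real.log (n - M) ≤ 1 / ((n : ℝ) - M) := by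
      rw [← Real.log_div (by linarith) hpos.ne']
      refine (Real.log_le_sub_one_of_pos (by positivity)).trans (le_of_eq ?_)
      field_simp
      ring
    have h2 : (n : ℝ) - (M + 1 : ℕ) + 1 = n - M := by push_cast; ring
    rw [h2]
    linarith [ih (by omega)]

theorem sum_comp_div (n c : ℕ) (hc : 0 < c) (g : ℕ → ℝ) :
    ∑ t : Fin (n * c), g ((t : ℕ) / c) = c * ∑ j ∈ Finset.range n, g j := by
  rw [← finProdFinEquiv.sum_comp, Fintype.sum_prod_type, ← Fin.sum_univ_eq_sum_range,
    Finset.mul_sum]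
  refine Finset.sum_congr rfl fun j _ => ?_
  have : ∀ r : Fin c, ((finProdFinEquiv (j, r) : Fin (n * c)) : ℕ) / c = j := fun r => by
    rw [finProdFinEquiv_apply_val, Nat.add_mul_div_left _ _ hc, Nat.div_eq_of_lt r.isLt, zero_add]
  rw [Finset.sum_congr rfl fun r _ => congrArg g (this r)]
  simp

/-- Suppose that for each order `σ` of `n` resources, `c` arrivals for each `j < n` are matched
fractionally to resources of position at least `j`, at most `c` to each resource, and that the
match does not depend on the order of the positions from `j` on. Then for some `σ` the match is
small. -/
theorem exists_perm_sum_le {n c : ℕ} (hc : 0 < c)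
    {q : Equiv.Perm (Fin n) → Fin (n * c) → Fin n → ℝ}
    (h0 : ∀ σ t i, 0 ≤ q σ t i) (h1 : ∀ σ t, ∑ i, q σ t i ≤ 1)
    (hz : ∀ σ (t : Fin (n * c)) i, (σ i : ℕ) < t / c → q σ t i = 0)
    (hcap : ∀ σ i, ∑ t, q σ t i ≤ c)
    (hq : ∀ σ σ' : Equiv.Perm (Fin n), ∀ t : Fin (n * c),
      (∀ i, ∀ k ≤ (t : ℕ) / c, k ≤ (σ i : ℕ) ↔ k ≤ (σ' i : ℕ)) → ∀ i, q σ t i = q σ' t i)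
    {M : ℕ} (hM : M ≤ n) :
    ∃ σ, ∑ t, ∑ i, q σ t i ≤
      c * (n - ((n : ℝ) - M) * (Real.log (n + 1) - Real.log (n - M + 1))) := by
  have hc0 : (0 : ℝ) < c := by exact_mod_cast hc
  set N : ℝ := (Fintype.card (Equiv.Perm (Fin n)) : ℝ) with hN
  have hN0 : 0 ≤ N := Nat.cast_nonneg _
  -- Up to the factor `N`, this is the expected mass that `t` sends to position `m` of a uniformly
  -- random order.
  set f : Fin (n * c) → Fin n → ℝ := fun t m => ∑ σ, q σ t (σ.symm m) with hf
  have hphase : ∀ t : Fin (n * c), (t : ℕ) / c < n := fun t =>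
    Nat.div_lt_of_lt_mul (lt_of_lt_of_eq t.isLt (mul_comm n c))
  have hf0 : ∀ (t : Fin (n * c)) (m : Fin n), (m : ℕ) < t / c → f t m = 0 := fun t m hm =>
    Finset.sum_eq_zero fun σ _ => hz σ t _ (by simpa using hm)
  -- Swapping two positions that have not yet dropped out cannot be noticed at `t`, so on average
  -- all surviving positions receive equal mass.
  have hswap : ∀ (t : Fin (n * c)) (m : Fin n), (t : ℕ) / c ≤ m →
      f t m = f t ⟨(t : ℕ) / c, hphase t⟩ := by
    intro t m hm
    set j : Fin n := ⟨(t : ℕ) / c, hphase t⟩ with hj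
    rw [hf]
    simp only
    rw [← Equiv.sum_comp (Equiv.mulLeft (Equiv.swap j m))]
    refine Finset.sum_congr rfl fun σ _ => ?_
    have h2 : (Equiv.mulLeft (Equiv.swap j m) σ).symm m = σ.symm j := by
      rw [Equiv.symm_apply_eq]
      simp
    rw [h2]
    refine hq _ _ t (fun i k hk => ?_) _
    simp only [Equiv.coe_mulLeft, Equiv.Perm.coe_mul, Function.comp_apply]
    have hjv : (j : ℕ) = (t : ℕ) / c := rfl
    by_cases e1 : σ i = j
    · rw [e1, Equiv.swap_apply_left]
      omega
    · by_cases e2 : σ i = m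
      · rw [e2, Equiv.swap_apply_right]
        omega
      · rw [Equiv.swap_apply_of_ne_of_ne e1 e2]
  have hfle : ∀ (t : Fin (n * c)) (m : Fin n), f t m ≤ N * (1 / ((n : ℝ) - (t / c : ℕ))) := by
    intro t m
    have hpos : 0 < (n : ℝ) - (t / c : ℕ) := by
      have : ((t / c : ℕ) : ℝ) < n := by exact_mod_cast hphase t
      linarith
    by_cases hm : (m : ℕ) < t / c
    · rw [hf0 t m hm]
      positivity
    · rw [hswap t m (not_lt.1 hm), mul_one_div, le_div_iff₀ hpos]
      have hcard : ((Finset.univ.filter fun m : Fin n => (t : ℕ) / c ≤ m).card : ℝ) =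
          n - (t / c : ℕ) := by
        have : (Finset.univ.filter fun m : Fin n => (t : ℕ) / c ≤ m) =
            Finset.Ici ⟨(t : ℕ) / c, hphase t⟩ := by
          ext m
          simp [Fin.le_def]
        rw [this, Fin.card_Ici, Nat.cast_sub (hphase t).le]
      calc f t ⟨(t : ℕ) / c, hphase t⟩ * ((n : ℝ) - (t / c : ℕ))
          = ∑ m ∈ Finset.univ.filter (fun m : Fin n => (t : ℕ) / c ≤ m), f t m := by
            rw [Finset.sum_congr rfl fun m hm => hswap t m (Finset.mem_filter.1 hm).2,
              Finset.sum_const, nsmul_eq_mul, hcard, mul_comm]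
        _ ≤ ∑ m, f t m := Finset.sum_le_sum_of_subset_of_nonneg (Finset.subset_univ _)
            fun m _ _ => Finset.sum_nonneg fun σ _ => h0 _ _ _
        _ = ∑ σ, ∑ i, q σ t i := by
            rw [hf, Finset.sum_comm]
            exact Finset.sum_congr rfl fun σ _ => σ.symm.sum_comp (q σ t)
        _ ≤ ∑ σ : Equiv.Perm (Fin n), 1 := Finset.sum_le_sum fun σ _ => h1 σ t
        _ = N := by simp [hN]
  have hload1 : ∀ m : Fin n, ∑ t, f t m ≤ N * c := fun m => by
    rw [hf, Finset.sum_comm]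
    refine (Finset.sum_le_sum fun σ _ => hcap σ _).trans (le_of_eq ?_)
    simp [hN]
  have hload2 : ∀ m : Fin n, ∑ t, f t m ≤
      N * c * ∑ j ∈ Finset.range ((m : ℕ) + 1), (1 / ((n : ℝ) - j)) := fun m => by
    calc ∑ t, f t m ≤ ∑ t : Fin (n * c), N *
          (fun j : ℕ => if j ≤ (m : ℕ) then 1 / ((n : ℝ) - j) else 0) ((t : ℕ) / c) := by
          refine Finset.sum_le_sum fun t _ => ?_
          simp only
          split_ifs with h
          · exact hfle t m
          · rw [hf0 t m (not_le.1 h), mul_zero]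
      _ = N * c * ∑ j ∈ Finset.range n, if j ≤ (m : ℕ) then 1 / ((n : ℝ) - j) else 0 := by
          rw [← Finset.mul_sum, sum_comp_div n c hc fun j : ℕ =>
            if j ≤ (m : ℕ) then 1 / ((n : ℝ) - j) else 0, mul_assoc]
      _ = _ := by
          rw [← Finset.sum_filter]
          congr 2
          ext j
          simp only [Finset.mem_filter, Finset.mem_range]
          have := m.isLt
          omega
  -- Positions below `M` are bounded by the harmonic sum `hload2`, because they drop out early; the
  -- others by their capacity.
  have htotal : ∑ σ, ∑ t, ∑ i, q σ t i ≤
      ∑ σ : Equiv.Perm (Fin n),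
        c * (n - ((n : ℝ) - M) * (Real.log (n + 1) - Real.log (n - M + 1))) := by
    calc ∑ σ, ∑ t, ∑ i, q σ t i = ∑ m, ∑ t, f t m := by
          rw [hf, Finset.sum_comm (γ := Fin n), Finset.sum_comm]
          refine Finset.sum_congr rfl fun t _ => ?_
          rw [Finset.sum_comm (γ := Fin n)]
          exact Finset.sum_congr rfl fun σ _ => (σ.symm.sum_comp (q σ t)).symm
      _ ≤ ∑ m : Fin n, (fun m : ℕ => if m < M then
            N * c * ∑ j ∈ Finset.range (m + 1), (1 / ((n : ℝ) - j)) else N * c) m := by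
          refine Finset.sum_le_sum fun m _ => ?_
          simp only
          split_ifs
          · exact hload2 m
          · exact hload1 m
      _ = N * c * (M - ((n : ℝ) - M) * ∑ j ∈ Finset.range M, (1 / ((n : ℝ) - j)) + (n - M)) := by
          rw [Fin.sum_univ_eq_sum_range (fun m : ℕ => if m < M then
            N * c * ∑ j ∈ Finset.range (m + 1), (1 / ((n : ℝ) - j)) else N * c) n,
            ← Finset.sum_range_add_sum_Ico _ hM, ← sum_sum_inv_eq hM]
          rw [Finset.sum_congr rfl fun m hm => if_pos (Finset.mem_range.1 hm),
            Finset.sum_congr rfl fun m hm => if_neg (not_lt.2 (Finset.mem_Ico.1 hm).1)]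
          rw [← Finset.mul_sum, Finset.sum_const, Nat.card_Ico, nsmul_eq_mul, Nat.cast_sub hM]
          ring
      _ ≤ N * c * (n - ((n : ℝ) - M) * (Real.log (n + 1) - Real.log (n - M + 1))) := by
          refine mul_le_mul_of_nonneg_left ?_ (by positivity)
          have hMn : 0 ≤ (n : ℝ) - M := sub_nonneg.2 (by exact_mod_cast hM)
          have := mul_le_mul_of_nonneg_left (log_sub_log_le_sum_inv hM) hMn
          linarith
      _ = _ := by
          rw [Finset.sum_const, nsmul_eq_mul, Finset.card_univ, ← hN]
          ring
  obtain ⟨σ, -, hσ⟩ := Finset.exists_le_of_sum_le Finset.univ_nonempty htotal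
  exact ⟨σ, hσ⟩

/-- For many resources, the bound of `exists_perm_sum_le` is close to `(1 - 1 / e) n c`. -/
theorem exists_sub_mul_log_lt {ε : ℝ} (hε : 0 < ε) :
    ∃ n : ℕ, 0 < n ∧ ∃ M ≤ n, (n : ℝ) - ((n : ℝ) - M) *
      (Real.log (n + 1) - Real.log (n - M + 1)) < (1 - 1 / Real.exp 1 + ε) * n := by
  obtain ⟨n, hn⟩ := exists_nat_gt (2 / ε)
  have hn0 : (0 : ℝ) < n := lt_trans (by positivity) hn
  have he0 := Real.exp_pos 1
  have he1 : 2 < Real.exp 1 := by linarith [Real.exp_one_gt_d9]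
  set e := Real.exp 1 with he
  have hK : ⌈(n : ℝ) / e⌉₊ ≤ n := by
    refine Nat.ceil_le.2 (div_le_self hn0.le (by linarith))
  -- With `n - M` about `n / e` the difference of logarithms is about `1`, and the bound about `n -
  -- n / e`. Rounding costs at most `2e / (n + 1)` in the logarithm, which `n > 2 / ε` makes less
  -- than `ε * e`.
  refine ⟨n, by exact_mod_cast hn0, n - ⌈(n : ℝ) / e⌉₊, Nat.sub_le _ _, ?_⟩
  rw [Nat.cast_sub hK]
  set K : ℝ := (⌈(n : ℝ) / e⌉₊ : ℝ) with hKdef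
  have hK1 : n / e ≤ K := Nat.le_ceil _
  have hK2 : K < n / e + 1 := Nat.ceil_lt_add_one (by positivity)
  have hK0 : 0 < K := lt_of_lt_of_le (by positivity) hK1
  have hsub : (n : ℝ) - (n - K) = K := by ring
  rw [hsub]
  have hx : 0 < ((n : ℝ) + 1) / (n + 2 * e) := by positivity
  have hlog : 1 - 2 * e / (n + 1) ≤ Real.log (n + 1) - Real.log (K + 1) := by
    have h1 : Real.log (K + 1) ≤ Real.log ((n + 2 * e) / e) := by
      refine Real.log_le_log (by linarith) ?_
      have : (n + 2 * e) / e = n / e + 2 := by field_simp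
      linarith
    have h2 : Real.log ((n + 2 * e) / e) = Real.log (n + 2 * e) - 1 := by
      rw [Real.log_div (by positivity) he0.ne', he, Real.log_exp]
    have h3 : Real.log (n + 2 * e) - Real.log (n + 1) ≤ 2 * e / (n + 1) := by
      rw [← Real.log_div (by positivity) (by positivity)]
      refine (Real.log_le_sub_one_of_pos (by positivity)).trans ?_
      have : (n + 2 * e) / (n + 1 : ℝ) - 1 = (2 * e - 1) / (n + 1) := by
        field_simp
        ring
      rw [this]
      gcongr
      linarith
    linarith
  have hsmall : 2 * e / (n + 1) < ε * e := by
    rw [div_lt_iff₀ hε] at hn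
    rw [div_lt_iff₀ (by positivity)]
    nlinarith
  have hlog0 : 0 ≤ Real.log (n + 1) - Real.log (K + 1) := by
    have : K ≤ n := Nat.cast_le.2 hK
    exact sub_nonneg.2 (Real.log_le_log (by linarith) (by linarith))
  have h1 := mul_le_mul_of_nonneg_right hK1 hlog0
  have h2 : n / e * (1 - ε * e) < n / e * (Real.log (n + 1) - Real.log (K + 1)) :=
    mul_lt_mul_of_pos_left (by linarith) (by positivity)
  have h3 : n / e * (1 - ε * e) = 1 / e * n - ε * n := by field_simp
  linarith

end

section

/-! ### Hard instances -/

/-- An online algorithm does not see the future. -/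
theorem matched_toPolicy_congr {R : Resources} (A : R.OnlineAlgorithm) {T : ℕ}
    {arr arr' : Fin T → R.Arrival} (h : Monotone fun t => (arr t).time)
    (h' : Monotone fun t => (arr' t).time) (u : Fin T → unitInterval)
    (d : Fin T → Fin R.n → ℝ≥0∞) {t : Fin T} (heq : ∀ s ≤ t, arr s = arr' s) :
    matched ⟨T, arr, h⟩ (A.toPolicy ⟨T, arr, h⟩) u d t =
      matched ⟨T, arr', h'⟩ (A.toPolicy ⟨T, arr', h'⟩) u d t := by
  obtain ⟨t, ht⟩ := t
  induction t using Nat.strong_induction_on with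
  | _ t ih =>
    rw [matched_eq, matched_eq]
    have h1 : (fun s : Fin t => matched ⟨T, arr, h⟩ (A.toPolicy ⟨T, arr, h⟩) u d
        (Fin.castLE ht.le s)) =
        fun s : Fin t => matched ⟨T, arr', h'⟩ (A.toPolicy ⟨T, arr', h'⟩) u d
          (Fin.castLE ht.le s) := by
      funext s
      exact ih s s.isLt (s.isLt.trans ht) fun r hr =>
        heq r (hr.trans (Fin.mk_le_mk.2 s.isLt.le))
    refine (congrArg (matchStep ⟨T, arr, h⟩ (A.toPolicy ⟨T, arr, h⟩) u d ⟨t, ht⟩) h1).trans ?_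
    have h2 : initialArrivals arr ⟨t, ht⟩ = initialArrivals arr' ⟨t, ht⟩ :=
      funext fun s => heq _ (Fin.mk_le_mk.2 (Nat.lt_succ_iff.1 s.isLt))
    have h3 : ∀ s : Fin t, arr (Fin.castLE ht.le s) = arr' (Fin.castLE ht.le s) := fun s =>
      heq _ (Fin.mk_le_mk.2 s.isLt.le)
    have h4 := heq ⟨t, ht⟩ le_rfl
    generalize (fun s : Fin t => matched ⟨T, arr', h'⟩ (A.toPolicy ⟨T, arr', h'⟩) u d
      (Fin.castLE ht.le s)) = past
    unfold matchStep elapsed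
    simp only [OnlineAlgorithm.toPolicy, h2, h3, h4]

/-- `n` resources of capacity `c` and reward `1` that are not reusable. -/
def singleUse (n c : ℕ) (hc : 0 < c) : Resources where
  n := n
  cap _ := c
  cap_pos _ := hc
  reward _ := 1
  usage _ := ⟨Measure.dirac ⊤, inferInstance⟩

theorem singleUse_isNonReusable (n c : ℕ) (hc : 0 < c) : (singleUse n c hc).IsNonReusable :=
  fun _ => rfl

theorem singleUse_cdf (n c : ℕ) (hc : 0 < c) (i : Fin n) (x : ℝ) :
    (singleUse n c hc).cdf i x = 0 := by
  have : (Measure.dirac (⊤ : ℝ≥0∞)) (Set.Iic (ENNReal.ofReal x)) = 0 := by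
    rw [Measure.dirac_apply' _ measurableSet_Iic]
    simp
  unfold cdf
  rw [NNReal.coe_eq_zero, ← ENNReal.coe_eq_zero, ProbabilityMeasure.ennreal_coeFn_eq_coeFn_toMeasure]
  exact this

/-- The `n * c` arrivals come in `n` rounds of `c`. The arrivals of round `j` have edges to the
resources that are at least `j`-th in the order `σ`. -/
def hardArrivals (n c : ℕ) (hc : 0 < c) (σ : Equiv.Perm (Fin n)) (t : Fin (n * c)) :
    (singleUse n c hc).Arrival where
  time := 0
  nbrs := Finset.univ.filter fun i : Fin n => (t : ℕ) / c ≤ σ i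

theorem monotone_hardArrivals (n c : ℕ) (hc : 0 < c) (σ : Equiv.Perm (Fin n)) :
    Monotone fun t => (hardArrivals n c hc σ t).time := fun _ _ _ => le_rfl

/-- The sequence of the arrivals `hardArrivals`. -/
def hardSeq (n c : ℕ) (hc : 0 < c) (σ : Equiv.Perm (Fin n)) : (singleUse n c hc).ArrivalSeq :=
  ⟨n * c, hardArrivals n c hc σ, monotone_hardArrivals n c hc σ⟩

theorem mem_hardArrivals_nbrs {n c : ℕ} {hc : 0 < c} {σ : Equiv.Perm (Fin n)} {t : Fin (n * c)}
    {i : Fin n} : i ∈ (hardArrivals n c hc σ t).nbrs ↔ (t : ℕ) / c ≤ σ i := by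
  unfold hardArrivals
  exact Finset.mem_filter.trans (and_iff_right (Finset.mem_univ _))

theorem hardArrivals_congr {n c : ℕ} {hc : 0 < c} {σ σ' : Equiv.Perm (Fin n)} {t : Fin (n * c)}
    (h : ∀ i, (t : ℕ) / c ≤ (σ i : ℕ) ↔ (t : ℕ) / c ≤ (σ' i : ℕ)) :
    hardArrivals n c hc σ t = hardArrivals n c hc σ' t := by
  unfold hardArrivals
  simp only [h]

/-- Nothing returns, so the occupancy at the last arrival counts all matches ever made. -/
theorem sum_matchProb_hardSeq_le {n c : ℕ} {hc : 0 < c} {σ : Equiv.Perm (Fin n)}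
    (P : (singleUse n c hc).Policy (n * c)) (i : Fin n) :
    ∑ t : Fin (n * c), matchProb (hardSeq n c hc σ) P t i ≤ c := by
  rcases Nat.eq_zero_or_pos (n * c) with h | h
  · have : IsEmpty (Fin (n * c)) := by rw [h]; infer_instance
    simp
  · set last : Fin (n * c) := ⟨n * c - 1, by omega⟩ with hlast
    refine le_trans (le_of_eq (Finset.sum_congr rfl fun t _ => ?_))
      (sum_occupancy_mul_matchProb_le (G := hardSeq n c hc σ) P last i)
    have hle : t ≤ last := by
      rw [Fin.le_def]
      have := t.isLt
      simp only [hlast]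
      omega
    have : occupancy (hardSeq n c hc σ).arr i t last = 1 := by
      rcases hle.lt_or_eq with hlt | heq
      · refine (occupancy_of_lt hlt).trans ?_
        rw [singleUse_cdf, sub_zero]
      · rw [heq]
        exact (isOccupancyKernel (hardSeq n c hc σ).mono i).diag last
    rw [this, one_mul]

/-- On a hard instance, match round `j` to the `j`-th resource. -/
def roundPolicy (n c : ℕ) (hc : 0 < c) (σ : Equiv.Perm (Fin n)) :
    (singleUse n c hc).Policy (n * c) where
  choose t _ _ _ := some (σ.symm ⟨t / c,
    Nat.div_lt_of_lt_mul (lt_of_lt_of_eq t.isLt (mul_comm n c))⟩)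
  measurable_choose _ _ _ := MeasurableSet.const _

/-- Only earlier arrivals of the same round use the same resource, and there are `t % c < c` of
them. -/
theorem matched_roundPolicy (n c : ℕ) (hc : 0 < c) (σ : Equiv.Perm (Fin n))
    (u : Fin (n * c) → unitInterval) (d : Fin (n * c) → Fin n → ℝ≥0∞) (t : Fin (n * c)) :
    matched (hardSeq n c hc σ) (roundPolicy n c hc σ) u d t = some (σ.symm ⟨t / c,
      Nat.div_lt_of_lt_mul (lt_of_lt_of_eq t.isLt (mul_comm n c))⟩) := by
  obtain ⟨t, ht⟩ := t
  induction t using Nat.strong_induction_on with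
  | _ t ih =>
    refine matched_eq_some_iff.2 ⟨rfl, ?_, ?_⟩
    · refine mem_hardArrivals_nbrs.2 ?_
      rw [Equiv.apply_symm_apply]
    · have hlt : t % c < c := Nat.mod_lt t hc
      refine lt_of_le_of_lt ?_ hlt
      have hcard : (Finset.Ico (c * (t / c)) t).card = t % c := by
        rw [Nat.card_Ico]
        have := Nat.div_add_mod t c
        omega
      rw [← hcard]
      refine Finset.card_le_card_of_injOn (fun s => (s : ℕ)) (fun s hs => ?_)
        (fun s _ s' _ h => Fin.ext h)
      have hs' := (Finset.mem_filter.1 hs).2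
      have h1 : (s : ℕ) < t := hs'.1
      have h2 := (ih s h1 s.isLt).symm.trans hs'.2.1
      have h3 := congrArg Fin.val (σ.symm.injective (Option.some_injective _ h2))
      simp only at h3
      refine Finset.mem_coe.2 (Finset.mem_Ico.2 ⟨?_, h1⟩)
      rw [← h3]
      exact Nat.mul_div_le _ _

theorem le_opt_hardSeq (n c : ℕ) (hc : 0 < c) (σ : Equiv.Perm (Fin n)) :
    ENNReal.ofReal ((n : ℝ) * c) ≤ opt (hardSeq n c hc σ) := by
  have h1 : (roundPolicy n c hc σ).value (hardSeq n c hc σ) = ENNReal.ofReal ((n : ℝ) * c) := by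
    have h2 : ∀ ω : (Fin (n * c) → unitInterval) × (Fin (n * c) → Fin n → ℝ≥0∞),
        ∑ t : Fin (n * c), matchReward (matched (hardSeq n c hc σ) (roundPolicy n c hc σ)
          ω.1 ω.2 t) = ((n * c : ℕ) : ℝ≥0∞) := fun ω => by
      rw [Finset.sum_congr rfl fun t _ => congrArg matchReward
        (matched_roundPolicy n c hc σ ω.1 ω.2 t)]
      simp [matchReward, singleUse]
    refine (lintegral_congr h2).trans ((lintegral_const (μ := law (singleUse n c hc) (n * c))
      ((n * c : ℕ) : ℝ≥0∞)).trans ?_)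
    rw [measure_univ, mul_one, ← Nat.cast_mul, ENNReal.ofReal_natCast]
  rw [← h1]
  exact le_iSup (fun P : (singleUse n c hc).Policy (n * c) => P.value (hardSeq n c hc σ)) _

/-- The law of seeds and durations is the same for all `σ`, and orders with equal neighbourhoods up
to `t` give equal matches at `t`. So the match probabilities meet the hypotheses of
`exists_perm_sum_le`, even for randomized adaptive algorithms. -/
theorem exists_hardSeq (n c : ℕ) (hc : 0 < c) (A : (singleUse n c hc).OnlineAlgorithm) {M : ℕ}
    (hM : M ≤ n) :
    ∃ σ, A.value (hardSeq n c hc σ) ≤ ENNReal.ofReal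
      (c * (n - ((n : ℝ) - M) * (Real.log (n + 1) - Real.log (n - M + 1)))) := by
  obtain ⟨σ, hσ⟩ := exists_perm_sum_le hc
    (q := fun σ t i => matchProb (hardSeq n c hc σ) (A.toPolicy (hardSeq n c hc σ)) t i)
    (fun σ t i => matchProb_nonneg (G := hardSeq n c hc σ) _ t i)
    (fun σ t => sum_matchProb_le_one (G := hardSeq n c hc σ) _ t)
    (fun σ t i h => matchProb_eq_zero (G := hardSeq n c hc σ) _ fun hi =>
      absurd (mem_hardArrivals_nbrs.1 hi) (not_le.2 h))
    (fun σ i => sum_matchProb_hardSeq_le _ i)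
    (fun σ σ' t h i => by
      have : ∀ s ≤ t, hardArrivals n c hc σ s = hardArrivals n c hc σ' s := fun s hs =>
        hardArrivals_congr fun i => h i _ (Nat.div_le_div_right hs)
      unfold matchProb
      congr 1
      ext ω
      have h := matched_toPolicy_congr A (monotone_hardArrivals n c hc σ)
        (monotone_hardArrivals n c hc σ') ω.1 ω.2 this
      exact Eq.congr_left h) hM
  refine ⟨σ, ?_⟩
  rw [OnlineAlgorithm.value, value_eq_ofReal]
  refine ENNReal.ofReal_le_ofReal (le_trans (le_of_eq ?_) hσ)
  refine Finset.sum_congr rfl fun t _ => Finset.sum_congr rfl fun i _ => ?_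
  have : (((singleUse n c hc).reward i : ℝ≥0) : ℝ) = 1 := NNReal.coe_one
  rw [this, one_mul]

/-- No online algorithm is better than `(1 - 1 / e)`-competitive, even for large capacities. -/
theorem exists_hard_instance {ε : ℝ} (hε : 0 < ε) (N : ℕ)
    (A : (R : Resources) → R.OnlineAlgorithm) :
    ∃ (R : Resources) (G : R.ArrivalSeq), N ≤ R.cmin ∧ R.IsNonReusable ∧
      (A R).value G < ENNReal.ofReal (1 - 1 / Real.exp 1 + ε) * opt G := by
  obtain ⟨n, hn, M, hM, hlt⟩ := exists_sub_mul_log_lt hε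
  -- Capacity `N + 1` rather than `N`, to be positive also for `N = 0`.
  obtain ⟨σ, hσ⟩ := exists_hardSeq n (N + 1) N.succ_pos (A _) hM
  refine ⟨singleUse n (N + 1) N.succ_pos, hardSeq n (N + 1) N.succ_pos σ, ?_,
    singleUse_isNonReusable _ _ _, lt_of_le_of_lt hσ ?_⟩
  · have : Nonempty (Fin (singleUse n (N + 1) N.succ_pos).n) := ⟨⟨0, hn⟩⟩
    exact le_ciInf fun _ => N.le_succ
  · have he : 1 / Real.exp 1 < 1 := by
      rw [div_lt_one (Real.exp_pos 1)]
      exact Real.one_lt_exp_iff.2 one_pos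
    have hn0 : (0 : ℝ) < n := by exact_mod_cast hn
    have hβ : 0 < 1 - 1 / Real.exp 1 + ε := by linarith
    refine lt_of_lt_of_le ?_ (mul_le_mul_right (le_opt_hardSeq n (N + 1) N.succ_pos σ) _)
    rw [← ENNReal.ofReal_mul hβ.le]
    have hc0 : (0 : ℝ) < ((N + 1 : ℕ) : ℝ) := by exact_mod_cast N.succ_pos
    refine (ENNReal.ofReal_lt_ofReal_iff (by positivity)).2 ?_
    have := mul_lt_mul_of_pos_left hlt hc0
    linarith

end

end Resources

end ReusableMatching

end

theorem theorem1 :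
    -- SAMPLE is non-adaptive, and `(1 - 1/e - δ)`-competitive, with `δ` a function of `c_min`
    (∃ δ : ℕ → ℝ,
      δ =O[atTop] (fun c : ℕ => √(Real.log c / c)) ∧
      Tendsto (fun c : ℕ => 1 - 1 / Real.exp 1 - δ c) atTop (𝓝 (1 - 1 / Real.exp 1)) ∧
      ∀ (R : Resources) (tb : TieBreak R.Item),
        (sample R tb).IsNonAdaptive ∧
        ∀ G : R.ArrivalSeq,
          ENNReal.ofReal (1 - 1 / Real.exp 1 - δ R.cmin) * opt G ≤ (sample R tb).value G) ∧
    -- no online algorithm has a better asymptotic guarantee, even for non-reusable resources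
    (∀ (ε : ℝ) (_ : 0 < ε) (N : ℕ) (A : (R : Resources) → R.OnlineAlgorithm),
      ∃ (R : Resources) (G : R.ArrivalSeq), N ≤ R.cmin ∧ R.IsNonReusable ∧
        (A R).value G < ENNReal.ofReal (1 - 1 / Real.exp 1 + ε) * opt G) := by
  refine ⟨⟨sampleLoss, sampleLoss_isBigO, ?_, fun R tb =>
    ⟨fun _ _ _ _ _ _ _ => rfl, fun G => ofReal_mul_opt_le_sample tb G⟩⟩,
    fun ε hε N A => exists_hard_instance hε N A⟩
  simpa using tendsto_sampleLoss.const_sub (1 - 1 / Real.exp 1)
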